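/- **Setting.** There are $N\ge 2$ buyers. Buyer $n$ has an unknown value $X_n$ (a real random variable) and privately observes a signal $Y_n$ with values in an interval $I\subseteq\mathbb R$. "Increasing" means strictly increasing. Assume: * the law of $(X_n,Y_n,\mathbf Y_{-n})$ is the same for each $n$ and symmetric in the last $N-1$ components; * $\mathbf Y=(Y_1,\dots,Y_N)$ has a density that is positive on $I^N$; versions of the density and of the conditional laws of $X_n$ given $\mathbf Y=\mathbf y$ are fixed, the latter sharing the above symmetry for every $\mathbf y\in I^N$; * for every increasing $h$, $E[h(X_1)\mid Y_i\in[a_i,b_i],\ 1\le i\le N]$ ($a_i\le b_i$ in $I$, where $a_i=b_i$ means conditioning on $Y_i=a_i$) is increasing in $a_1,b_1$ and nondecreasing in the other $a_i,b_i$, whenever it exists; * all buyers have the same utility $u:\mathbb R\to\mathbb R$, concave and increasing with $u(0)=0$, and $E[u(X_1)\mid \mathbf Y=\mathbf y]>0$ for all $\mathbf y\in I^N$. Fix $\alpha\in[0,1)$. A winner with value $x$ who pays $b$ in the auction then pays the seller $\alpha\max\{0,x-b\}$ under the profit only sharing contract (POSC), or $\alpha(x-b)$ under the profit and loss sharing contract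 (PLSC). For $y_1\in I$ and $\mathbf z\in I^{N-1}$ let $s(\alpha,y_1,\mathbf z)$ be the solution $b$ of $$E\big[u\big(X_1-b-\alpha\max\{0,X_1-b\}\big)\mid Y_1=y_1,\ \mathbf Y_{-1}=\mathbf z\big]=0,$$ and let $t(\alpha,y_1,\mathbf z)$ be the solution of $E[u((1-\alpha)(X_1-b))\mid Y_1=y_1,\mathbf Y_{-1}=\mathbf z]=0$; the order of the entries of $\mathbf z$ is irrelevant. Let $\mathbf Z=(Z_1\ge\dots\ge Z_{N-1})$ be the ordered signals of buyers $2,\dots,N$. Assume that the conditional expected utility of winning at a price $b$ given $\mathbf Y=\mathbf y$ is finite for all $b$ and all $\mathbf y\in I^N$, and that the utility of buyer 1 from winning at the price $s(\alpha,Z_1,\mathbf Z)$ (resp. $t(\alpha,Z_1,\mathbf Z)$) is integrable. In the English auction the price rises continuously from $-\infty$; the price, the number of active buyers and the past drop-out prices are public. A strategy prescribes the price at which to drop out as a function of one's own signal and of the past drop-out prices $p_1\le p_2\le\cdots$ (one drops out at once if the prescribed price has been passed); simultaneous drop-outs are ordered by a fixed priority among the buyers. The auction ends with the $(N-1)$-st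 drop-out, and the remaining buyer pays its price; losers get utility $0$. **Claim (POSC).** The number $s(\alpha,y_1,\mathbf z)$ exists and is unique for all $(y_1,\mathbf z)\in I^N$. Given drop-out prices $p_1\le p_2\le\cdots$, define recursively, for $1\le k\le N-1$, $q_k\in I$ as the solution $b$ of $$s\big(\alpha,\underbrace{b,\dots,b}_{N-k+1},q_{k-1},\dots,q_1\big)=p_k ,$$ and as an arbitrary element of $I$, depending on $p_1,\dots,p_k$ only, if there is no solution in $I$. There is at most one solution in $I$, and $q_k\le q_{k+1}$ whenever both equations are solvable. Let every buyer $n$ use the strategy $$\beta^k(y_n,p_{N-k},\dots,p_1)=s\big(\alpha,\underbrace{y_n,\dots,y_n}_{k},q_{N-k},\dots,q_1\big),\qquad 2\le k\le N,$$ where $k$ is the number of active buyers. Then this profile is a symmetric perfect Bayesian equilibrium of the English auction with the POSC, with beliefs under which the signals of the buyers who have dropped out are $q_1,q_2,\dots$: at every information set (own signal, past drop-out prices, current price) each buyer has a belief about the others' signals and about who is still active, no deviation by a measurable strategy raises his expected utility from the continuation, and beliefs follow from Bayes' rule at all information sets of a buyer that are reached when the other buyers use $\beta$ (whether or not he himself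 has deviated). **Claim (PLSC).** The same holds for the English auction with the PLSC, with $t$ in place of $s$. -/

import Mathlib

open MeasureTheory ProbabilityTheory

noncomputable section

namespace ProfitSharing

/-! ### Contracts and expected utility -/

/-- The two profit sharing contracts: profit only (`posc`), profit and loss (`plsc`). -/
inductive Contract
  | posc
  | plsc

/-- Second stage payment to the seller when the preliminary profit is `w`. -/
def Contract.payment (C : Contract) (α w : ℝ) : ℝ :=
  match C with
  | .posc => α * max 0 w
  | .plsc => α * w

/-- Total profit of a winner whose value is `x` and who pays `b` in the auction stage. -/
def profit (C : Contract) (α x b : ℝ) : ℝ := (x - b) - C.payment α (x - b)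

/-- The signal vectors all of whose entries lie in `I`. -/
def signalSpace (N : ℕ) (I : Set ℝ) : Set (Fin N → ℝ) := {y | ∀ i, y i ∈ I}

/-- Expected utility of buyer `n` from winning at the price `b`, given the vector `y` of all
signals; `κ n y` is the conditional law of his value given that vector. -/
def winUtility {N : ℕ} (κ : Fin N → Kernel (Fin N → ℝ) ℝ) (u : ℝ → ℝ) (C : Contract) (α : ℝ)
    (n : Fin N) (y : Fin N → ℝ) (b : ℝ) : ℝ :=
  ∫ x, u (profit C α x b) ∂(κ n y)

/-- The price at which the expected utility of the first buyer from winning is zero, given that his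
own signal is `y 0` and those of the others are the remaining entries of `y` (in any order): the
function `s` for the profit only contract, and `t` for the profit and loss contract. -/
def indiffPrice {N : ℕ} [NeZero N] (κ : Fin N → Kernel (Fin N → ℝ) ℝ) (u : ℝ → ℝ) (C : Contract)
    (α : ℝ) (y : Fin N → ℝ) : ℝ :=
  Classical.epsilon fun b => winUtility κ u C α 0 y b = 0

/-! ### The model -/

/-- Reference measure on the box `∏ [a i, b i]`: Lebesgue measure in the coordinates with
`a i < b i`, a point mass in the coordinates with `a i = b i`. -/
def boxMeasure {N : ℕ} (a b : Fin N → ℝ) : Measure (Fin N → ℝ) :=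
  Measure.pi fun i => if a i = b i then Measure.dirac (a i) else volume.restrict (Set.Icc (a i) (b i))

/-- The unnormalized law of the signals on the box, when they have density `f`. -/
def boxWeight {N : ℕ} (f : (Fin N → ℝ) → ℝ) (a b : Fin N → ℝ) : Measure (Fin N → ℝ) :=
  (boxMeasure a b).withDensity fun y => ENNReal.ofReal (f y)

/-- The conditional law of a value given that the signals lie in the box `∏ [a i, b i]`, when `k`
is its conditional law given the signals. -/
def boxLaw {N : ℕ} (f : (Fin N → ℝ) → ℝ) (k : Kernel (Fin N → ℝ) ℝ) (a b : Fin N → ℝ) :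
    Measure ℝ :=
  ((boxWeight f a b Set.univ)⁻¹ • boxWeight f a b).bind k

/-- The conditional expectation of `h` of the value given the box exists and is finite. -/
def BoxExpExists {N : ℕ} (f : (Fin N → ℝ) → ℝ) (k : Kernel (Fin N → ℝ) ℝ) (h : ℝ → ℝ)
    (a b : Fin N → ℝ) : Prop :=
  boxWeight f a b Set.univ ≠ ⊤ ∧ Integrable h (boxLaw f k a b)

/-- The symmetric interdependent values model with `N` buyers. `X n` and `Y n` are the value and
the signal of buyer `n`, `I` is the interval of signals, `f` the density of the signal vector,
`κ n` (a version of) the conditional law of `X n` given the signal vector, `u` the utility. -/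
structure Model {Ω : Type*} [MeasurableSpace Ω] (P : Measure Ω) {N : ℕ} [NeZero N]
    (X Y : Fin N → Ω → ℝ) (I : Set ℝ) (f : (Fin N → ℝ) → ℝ)
    (κ : Fin N → Kernel (Fin N → ℝ) ℝ) (u : ℝ → ℝ) : Prop where
  measurable_X : ∀ n, Measurable (X n)
  measurable_Y : ∀ n, Measurable (Y n)
  interval : I.OrdConnected
  signal_mem : ∀ n ω, Y n ω ∈ I
  /-- The law of `(X n, Y n, Y_{-n})` is the same for each `n` and symmetric in the last `N - 1`
  components. -/
  law_symm : ∀ (π : Equiv.Perm (Fin N)) (n : Fin N),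
    P.map (fun ω => (X (π n) ω, fun i => Y (π i) ω)) = P.map (fun ω => (X n ω, fun i => Y i ω))
  measurable_f : Measurable f
  density : P.map (fun ω i => Y i ω) = volume.withDensity fun y => ENNReal.ofReal (f y)
  density_pos : ∀ y ∈ signalSpace N I, 0 < f y
  markov : ∀ n, IsMarkovKernel (κ n)
  /-- `κ n` is a regular conditional law of `X n` given the signal vector. -/
  cond_law : ∀ n, P.map (fun ω => ((fun i => Y i ω), X n ω)) = (P.map fun ω i => Y i ω) ⊗ₘ κ n
  /-- The versions of the conditional laws have the symmetry of the joint law. -/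
  cond_symm : ∀ (π : Equiv.Perm (Fin N)) (n : Fin N), ∀ y ∈ signalSpace N I,
    κ (π n) y = κ n fun i => y (π i)
  /-- Positive dependence: `E[h(X 0) | Y i ∈ [a i, b i] for all i]` is increasing in `a 0` and
  `b 0`, and nondecreasing in the other `a i` and `b i`. -/
  pos_dep : ∀ h : ℝ → ℝ, StrictMono h → ∀ a b a' b' : Fin N → ℝ,
    a ∈ signalSpace N I → b ∈ signalSpace N I → a' ∈ signalSpace N I → b' ∈ signalSpace N I →
    a ≤ b → a' ≤ b' → a ≤ a' → b ≤ b' →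
    BoxExpExists f (κ 0) h a b → BoxExpExists f (κ 0) h a' b' →
    (∫ x, h x ∂(boxLaw f (κ 0) a b) ≤ ∫ x, h x ∂(boxLaw f (κ 0) a' b')) ∧
    ((a 0 < a' 0 ∨ b 0 < b' 0) →
      ∫ x, h x ∂(boxLaw f (κ 0) a b) < ∫ x, h x ∂(boxLaw f (κ 0) a' b'))
  concave : ConcaveOn ℝ Set.univ u
  increasing : StrictMono u
  normalized : u 0 = 0
  utility_pos : ∀ y ∈ signalSpace N I, Integrable u (κ 0 y) ∧ 0 < ∫ x, u x ∂(κ 0 y)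

/-- Finiteness of the expected utilities that occur in the auction: those of winning at a given
price conditional on the signals, and that of winning at the price `s(α, Z 1, Z)`. -/
structure FiniteUtilities {Ω : Type*} [MeasurableSpace Ω] (P : Measure Ω) {N : ℕ} [NeZero N]
    (X Y : Fin N → Ω → ℝ) (I : Set ℝ) (κ : Fin N → Kernel (Fin N → ℝ) ℝ) (u : ℝ → ℝ)
    (C : Contract) (α : ℝ) : Prop where
  conditional : ∀ y ∈ signalSpace N I, ∀ b : ℝ, Integrable (fun x => u (profit C α x b)) (κ 0 y)
  winning : Integrable (fun ω => u (profit C α (X 0 ω)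
    (indiffPrice κ u C α
      (Function.update (fun i => Y i ω) 0 (⨆ j : {j : Fin N // j ≠ 0}, Y j ω))))) P

/-! ### The English auction -/

/-- A strategy: the price at which the buyer drops out, as a function of his signal and of the list
`[p_m, …, p_1]` of the drop-out prices so far, most recent first. -/
abbrev Strategy := ℝ → List ℝ → ℝ

/-- The price shown by the clock just after the last drop-out; `⊥` before the first one. -/
def clock : List ℝ → EReal
  | [] => ⊥
  | p :: _ => (p : EReal)

/-- The price at which buyer `i` drops out if the drop-out prices so far are `h`, the clock shows
`c`, and no one else drops out before: at once if the price his strategy names has passed. -/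
def exitPrice {N : ℕ} (σ : Fin N → Strategy) (y : Fin N → ℝ) (h : List ℝ) (c : EReal)
    (i : Fin N) : ℝ :=
  (max c ((σ i (y i) h : ℝ) : EReal)).toReal

/-- The buyer in `D` who leaves first if they leave at the prices `b`; ties are resolved by the
priority order `ρ`. -/
def firstOut {N : ℕ} [NeZero N] (ρ : Equiv.Perm (Fin N)) (b : Fin N → ℝ) (D : Finset (Fin N)) :
    Fin N :=
  Classical.epsilon fun i => i ∈ D ∧ ∀ j ∈ D, b i < b j ∨ (b i = b j ∧ ρ i ≤ ρ j)

/-- Winner and price when the auction goes on for `k` more drop-outs from the situation in which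
the drop-out prices so far are `h`, the clock shows `c`, and the active buyers are `S`. -/
def play {N : ℕ} [NeZero N] (ρ : Equiv.Perm (Fin N)) (σ : Fin N → Strategy) (y : Fin N → ℝ) :
    ℕ → List ℝ → EReal → Finset (Fin N) → Fin N × ℝ
  | 0, _, c, S => (Classical.epsilon fun i => i ∈ S, c.toReal)
  | k + 1, h, c, S =>
    let i := firstOut ρ (exitPrice σ y h c) S
    let p := exitPrice σ y h c i
    play ρ σ y k (p :: h) (p : EReal) (S.erase i)

/-- Drop-out prices and active buyers after `m` drop-outs, if buyer `n` stays in. -/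
def pathStaying {N : ℕ} [NeZero N] (ρ : Equiv.Perm (Fin N)) (σ : Fin N → Strategy)
    (y : Fin N → ℝ) (n : Fin N) : ℕ → List ℝ × Finset (Fin N)
  | 0 => ([], Finset.univ)
  | m + 1 =>
    let s := pathStaying ρ σ y n m
    let b := exitPrice σ y s.1 (clock s.1)
    let i := firstOut ρ b (s.2.erase n)
    (b i :: s.1, s.2.erase i)

/-- What buyer `n` has observed after `m` drop-outs, if he stays in: his own signal and the
drop-out prices. -/
def observed {N : ℕ} [NeZero N] (ρ : Equiv.Perm (Fin N)) (σ : Fin N → Strategy) (n : Fin N)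
    (m : ℕ) (y : Fin N → ℝ) : ℝ × (Fin m → ℝ) :=
  (y n, fun j => (pathStaying ρ σ y n m).1.getD j 0)

/-! ### Perfect Bayesian equilibrium -/

/-- A node of an information set: the vector of signals and the set of active buyers. -/
abbrev Node (N : ℕ) := (Fin N → ℝ) × Finset (Fin N)

/-- Beliefs: for each buyer, own signal, list of drop-out prices and clock price, a law on nodes. -/
abbrev Beliefs (N : ℕ) := Fin N → ℝ → List ℝ → EReal → Measure (Node N)

/-- An active buyer with signal `y` may observe the drop-out prices `h` and the clock price `c`
while the auction is still on. The case `c = ⊥` is the start of the auction. -/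
structure IsInfoSet (N : ℕ) (I : Set ℝ) (y : ℝ) (h : List ℝ) (c : EReal) : Prop where
  signal_mem : y ∈ I
  length_le : h.length + 2 ≤ N
  sorted : h.Pairwise (· ≥ ·)
  clock_le : clock h ≤ c
  lt_top : c < ⊤

/-- Measurability of a strategy. -/
def Strategy.IsMeasurable (τ : Strategy) : Prop :=
  ∀ m : ℕ, Measurable fun z : ℝ × (Fin m → ℝ) => τ z.1 (List.ofFn z.2)

/-- Payoff of buyer `n` from the continuation of the auction at a node; `V n y b` is his expected
utility from winning at price `b` given the signals `y`, and losers get `0`. -/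
def nodePayoff {N : ℕ} [NeZero N] (V : Fin N → (Fin N → ℝ) → ℝ → ℝ) (ρ : Equiv.Perm (Fin N))
    (σ : Fin N → Strategy) (n : Fin N) (h : List ℝ) (c : EReal) (d : Node N) : ℝ :=
  let o := play ρ σ d.1 (d.2.card - 1) h c d.2
  if o.1 = n then V n d.1 o.2 else 0

/-- `(σ, μ)` is a perfect Bayesian equilibrium of the English auction. -/
structure IsPBE {Ω : Type*} [MeasurableSpace Ω] (P : Measure Ω) {N : ℕ} [NeZero N]
    (Y : Fin N → Ω → ℝ) (I : Set ℝ) (V : Fin N → (Fin N → ℝ) → ℝ → ℝ)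
    (ρ : Equiv.Perm (Fin N)) (σ : Fin N → Strategy) (μ : Beliefs N) : Prop where
  /-- Beliefs are probability measures on the nodes of the information set. -/
  belief_prob : ∀ n y h c, IsInfoSet N I y h c → IsProbabilityMeasure (μ n y h c)
  belief_support : ∀ n y h c, IsInfoSet N I y h c → ∀ᵐ d ∂(μ n y h c),
    d.1 ∈ signalSpace N I ∧ d.1 n = y ∧ n ∈ d.2 ∧ d.2.card + h.length = N
  /-- Bayes' rule, wherever the other buyers' strategies leave positive probability, whether or not
  buyer `n` himself has followed his own strategy. Suppose he looks at the clock at the price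
  `c = T (own signal, drop-out prices)`; on the event `A` that this happens after the `m`-th and
  before the next drop-out, his belief is the conditional law of the node given his observations.
  The rule `T` ranges over constant prices, over the price of the last drop-out, and so on. -/
  bayes : ∀ (n : Fin N) (m : ℕ), m + 2 ≤ N →
    ∀ T : ℝ × (Fin m → ℝ) → EReal, Measurable T →
    ∀ A : Set Ω, A = {ω |
      clock (pathStaying ρ σ (fun i => Y i ω) n m).1 ≤ T (observed ρ σ n m fun i => Y i ω) ∧
      T (observed ρ σ n m fun i => Y i ω) < clock (pathStaying ρ σ (fun i => Y i ω) n (m + 1)).1} →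
    ∀ B : Set (Node N), MeasurableSet B →
      (fun ω => (μ n (Y n ω) (pathStaying ρ σ (fun i => Y i ω) n m).1
          (T (observed ρ σ n m fun i => Y i ω))).real B)
        =ᵐ[P[|A]]
      (P[|A])[Set.indicator
          {ω | ((fun i => Y i ω), (pathStaying ρ σ (fun i => Y i ω) n m).2) ∈ B}
          (fun _ => (1 : ℝ)) |
        MeasurableSpace.comap (fun ω => observed ρ σ n m fun i => Y i ω) inferInstance]
  /-- Sequential rationality at every information set. -/
  payoff_integrable : ∀ n y h c, IsInfoSet N I y h c →
    Integrable (nodePayoff V ρ σ n h c) (μ n y h c)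
  rational : ∀ n y h c, IsInfoSet N I y h c → ∀ τ : Strategy, τ.IsMeasurable →
    Integrable (nodePayoff V ρ (Function.update σ n τ) n h c) (μ n y h c) ∧
    ∫ d, nodePayoff V ρ (Function.update σ n τ) n h c d ∂(μ n y h c)
      ≤ ∫ d, nodePayoff V ρ σ n h c d ∂(μ n y h c)

/-! ### The candidate strategy -/

/-- The vector `(y, …, y, q_m, …, q_1)` of length `N`, where `qs = [q_m, …, q_1]`. -/
def stack (N : ℕ) (y : ℝ) (qs : List ℝ) : Fin N → ℝ :=
  fun i => (List.replicate (N - qs.length) y ++ qs).getD i y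

/-- The list `[q_m, …, q_1]` of signals inferred from `[p_m, …, p_1]`, where `q [p_k, …, p_1]` is
the signal inferred for the `k`-th buyer to drop out. -/
def inferred (q : List ℝ → ℝ) : List ℝ → List ℝ
  | [] => []
  | p :: h => q (p :: h) :: inferred q h

/-- The equation `w (b, …, b, q_{k-1}, …, q_1) = p` that defines `q_k`, where `h` lists
`p_{k-1}, …, p_1`. -/
def SignalEq {N : ℕ} (w : (Fin N → ℝ) → ℝ) (q : List ℝ → ℝ) (h : List ℝ) (p b : ℝ) : Prop :=
  w (stack N b (inferred q h)) = p

/-- `q` is an inference rule: `q_k` is a signal, and it solves its defining equation whenever that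
equation has a solution. After a price for which there is none (such prices do not occur if all
buyers use the candidate strategy) it may be any signal. -/
structure IsInference {N : ℕ} (w : (Fin N → ℝ) → ℝ) (I : Set ℝ) (q : List ℝ → ℝ) : Prop where
  mem : ∀ p h, q (p :: h) ∈ I
  solves : ∀ p h, h.length + 2 ≤ N → (∃ b ∈ I, SignalEq w q h p b) → SignalEq w q h p (q (p :: h))

/-- The strategy `β^k (y, p_{N-k}, …, p_1) = w (y, …, y, q_{N-k}, …, q_1)`. -/
def bid {N : ℕ} (w : (Fin N → ℝ) → ℝ) (q : List ℝ → ℝ) : Strategy :=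
  fun y h => w (stack N y (inferred q h))

end ProfitSharing

end

set_option linter.unusedSectionVars false

namespace ProfitSharing

/-! ### The profit of a winner -/

/-! Fix the signals `y`. On degenerate boxes, positive dependence says that the expected utility
from winning at a price `b` is nondecreasing in `y` and strictly increasing in the own signal. In
`b` it is strictly decreasing and concave, positive somewhere and negative somewhere. So it has
exactly one zero, the indifference price, which inherits monotonicity and symmetry. `IsPriceRule`
records this for both contracts at once (`isPriceRule_indiffPrice`), and the strategic analysis uses
nothing else about the model.

The equilibrium is ex post. Let the others follow `bid`. Bids are strictly increasing in the own
signal, so the others leave in the order of their signals, and each drop-out price reveals the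
signal behind it (`inference_bid`). The bid of the last rival is the indifference price buyer `n`
would have if his signal were the highest rival signal `m`. Hence whatever buyer `n` does, winning
costs him `finalPrice` at `m` (`IsConsistent.price_of_win`), and his strategy decides only whether
he wins. Winning at that price has nonnegative utility if `m ≤ y n` and nonpositive utility if `y n
≤ m`, while `bid` wins if `m < y n` and only if `m ≤ y n`. So `bid` is optimal node by node
(`IsConsistent.nodePayoff_le`), whatever the weights a belief gives to such nodes.

Beliefs at reached information sets are the conditional law of the signals given own signal and
drop-out prices, conditioned once more on the next drop-out lying above the clock;
`cond_condDistrib_ae_eq_condExp` shows that this is Bayes' rule. Conditional laws behave well only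
almost surely, so at all other information sets the belief is a point mass at a node where `bid` is
optimal and the departed have the inferred signals (`exists_node_nodePayoff_le`).

Measurability needs care: `q` is not assumed measurable and `indiffPrice` is uncontrolled off the
signal space. The path of the auction is therefore rewritten in terms of the signals alone
(`orderPath`, `pricePath`, with a measurable version `w'` of the price rule), and `isOnPath`
identifies the two descriptions. -/

theorem profit_strictMono (C : Contract) {α : ℝ} (hα0 : 0 ≤ α) (hα1 : α < 1) (b : ℝ) :
    StrictMono fun x => profit C α x b := by
  intro x x' hx
  cases C
  · simp only [profit, Contract.payment]
    rcases le_total 0 (x - b) with h | h <;> rcases le_total 0 (x' - b) with h' | h' <;>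
      simp only [max_eq_left, max_eq_right, h, h'] <;> nlinarith
  · simp only [profit, Contract.payment]
    nlinarith

/-- Only the difference of value and price matters, so monotonicity in the value also gives
monotonicity in the price. -/
theorem profit_eq_sub (C : Contract) (α x b : ℝ) : profit C α x b = profit C α (x - b) 0 := by
  simp [profit]

/-- The payment under `posc` is `α ≥ 0` times the convex function `max 0 (x - b)`, and it is
subtracted; under `plsc` everything is affine. -/
theorem profit_concaveOn (C : Contract) {α : ℝ} (hα0 : 0 ≤ α) (x : ℝ) :
    ConcaveOn ℝ Set.univ fun b => profit C α x b := by
  refine ⟨convex_univ, fun b _ c _ s t hs ht hst => ?_⟩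
  obtain rfl : t = 1 - s := by linarith
  cases C
  · simp only [profit, Contract.payment, smul_eq_mul]
    have h1 : max 0 (x - (s * b + (1 - s) * c)) ≤ s * max 0 (x - b) + (1 - s) * max 0 (x - c) := by
      apply max_le
      · positivity
      · have := mul_le_mul_of_nonneg_left (le_max_right 0 (x - b)) hs
        have := mul_le_mul_of_nonneg_left (le_max_right 0 (x - c)) ht
        linarith
    have := mul_le_mul_of_nonneg_left h1 hα0
    linarith
  · simp only [profit, Contract.payment, smul_eq_mul]
    linarith

theorem measurable_profit (C : Contract) (α : ℝ) :
    Measurable fun z : ℝ × ℝ => profit C α z.1 z.2 := by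
  cases C <;> simp only [profit, Contract.payment] <;> fun_prop

/-! ### Degenerate boxes -/

theorem boxWeight_self {N : ℕ} {f : (Fin N → ℝ) → ℝ} (hf : Measurable f) (a : Fin N → ℝ) :
    boxWeight f a a = ENNReal.ofReal (f a) • Measure.dirac a := by
  have h : boxMeasure a a = Measure.dirac a := by
    unfold boxMeasure
    simp only [if_true]
    refine Measure.pi_eq (μ := fun i => Measure.dirac (a i)) fun s hs => ?_
    rw [Measure.dirac_apply' _ (MeasurableSet.univ_pi hs)]
    simp only [Measure.dirac_apply' _ (hs _)]
    by_cases h : ∀ i, a i ∈ s i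
    · rw [Set.indicator_of_mem (by simpa using h)]
      simp [h]
    · rw [Set.indicator_of_notMem (by simpa using h)]
      push Not at h
      obtain ⟨i, hi⟩ := h
      exact (Finset.prod_eq_zero (Finset.mem_univ i) (by simp [hi])).symm
  ext s hs
  classical
  rw [boxWeight, h, withDensity_apply _ hs, setLIntegral_dirac' (by fun_prop) hs]
  by_cases ha : a ∈ s <;> simp [hs, ha]

/-- The positive density at `a` cancels against the normalization. This turns `pos_dep` at
degenerate boxes into a statement about the fixed version `κ 0` at every signal vector, not just
almost every one. -/
theorem boxLaw_self {N : ℕ} {f : (Fin N → ℝ) → ℝ} (hf : Measurable f) (k : Kernel (Fin N → ℝ) ℝ)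
    {a : Fin N → ℝ} (ha : 0 < f a) : boxLaw f k a a = k a := by
  rw [boxLaw, boxWeight_self hf]
  have h0 : ENNReal.ofReal (f a) ≠ 0 := by simpa using ha
  have : ((ENNReal.ofReal (f a) • Measure.dirac a : Measure (Fin N → ℝ)) Set.univ)⁻¹ •
      ENNReal.ofReal (f a) • Measure.dirac a = Measure.dirac a := by
    rw [smul_smul]
    simp [ENNReal.inv_mul_cancel h0 ENNReal.ofReal_ne_top]
  rw [this, Measure.dirac_bind k.measurable]

theorem boxExpExists_self {N : ℕ} {f : (Fin N → ℝ) → ℝ} (hf : Measurable f)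
    (k : Kernel (Fin N → ℝ) ℝ) {a : Fin N → ℝ} (ha : 0 < f a) {h : ℝ → ℝ}
    (hh : Integrable h (k a)) : BoxExpExists f k h a a := by
  refine ⟨?_, by rwa [boxLaw_self hf k ha]⟩
  rw [boxWeight_self hf]
  simp

/-! ### The indifference price -/

section IndifferencePrice

variable {Ω : Type*} [MeasurableSpace Ω] {P : Measure Ω} {N : ℕ} [NeZero N]
  {X Y : Fin N → Ω → ℝ} {I : Set ℝ} {f : (Fin N → ℝ) → ℝ}
  {κ : Fin N → Kernel (Fin N → ℝ) ℝ} {u : ℝ → ℝ} {C : Contract} {α : ℝ}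

theorem Model.utility_profit_strictMono (hM : Model P X Y I f κ u) (hα0 : 0 ≤ α) (hα1 : α < 1)
    (b : ℝ) : StrictMono fun x => u (profit C α x b) :=
  hM.increasing.comp (profit_strictMono C hα0 hα1 b)

theorem winUtility_mono (hM : Model P X Y I f κ u) (hα0 : 0 ≤ α) (hα1 : α < 1)
    (hfin : FiniteUtilities P X Y I κ u C α) {x x' : Fin N → ℝ} (hx : x ∈ signalSpace N I)
    (hx' : x' ∈ signalSpace N I) (hle : x ≤ x') (b : ℝ) :
    winUtility κ u C α 0 x b ≤ winUtility κ u C α 0 x' b ∧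
    (x 0 < x' 0 → winUtility κ u C α 0 x b < winUtility κ u C α 0 x' b) := by
  have h := hM.pos_dep _ (hM.utility_profit_strictMono (C := C) hα0 hα1 b) x x x' x' hx hx hx' hx'
    le_rfl le_rfl hle hle
    (boxExpExists_self hM.measurable_f _ (hM.density_pos x hx) (hfin.conditional x hx b))
    (boxExpExists_self hM.measurable_f _ (hM.density_pos x' hx') (hfin.conditional x' hx' b))
  rw [boxLaw_self hM.measurable_f _ (hM.density_pos x hx),
    boxLaw_self hM.measurable_f _ (hM.density_pos x' hx')] at h
  exact ⟨h.1, fun h0 => h.2 (Or.inl h0)⟩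

/-- A higher price lowers the utility for every single value, and a function that is positive
everywhere has positive integral under a probability measure. -/
theorem winUtility_strictAnti (hM : Model P X Y I f κ u) (hα0 : 0 ≤ α) (hα1 : α < 1)
    (hfin : FiniteUtilities P X Y I κ u C α) {x : Fin N → ℝ} (hx : x ∈ signalSpace N I) :
    StrictAnti (winUtility κ u C α 0 x) := by
  intro b c hbc
  have hlt : ∀ z, u (profit C α z c) < u (profit C α z b) := fun z => by
    apply hM.increasing
    rw [profit_eq_sub, profit_eq_sub C α z b]
    exact profit_strictMono C hα0 hα1 0 (by linarith)
  have := hM.markov 0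
  have hpos : 0 < ∫ z, (u (profit C α z b) - u (profit C α z c)) ∂(κ 0 x) := by
    rw [integral_pos_iff_support_of_nonneg (fun z => sub_nonneg.2 (hlt z).le)
      ((hfin.conditional x hx b).sub (hfin.conditional x hx c))]
    have : (Function.support fun z => u (profit C α z b) - u (profit C α z c)) = Set.univ :=
      Set.eq_univ_of_forall fun z => (sub_pos.2 (hlt z)).ne'
    rw [this]
    simp
  rw [integral_sub (hfin.conditional x hx b) (hfin.conditional x hx c)] at hpos
  exact sub_pos.1 hpos

theorem winUtility_concaveOn (hM : Model P X Y I f κ u) (hα0 : 0 ≤ α)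
    (hfin : FiniteUtilities P X Y I κ u C α) {x : Fin N → ℝ} (hx : x ∈ signalSpace N I) :
    ConcaveOn ℝ Set.univ (winUtility κ u C α 0 x) := by
  refine ⟨convex_univ, fun b _ c _ s t hs ht hst => ?_⟩
  simp only [winUtility, smul_eq_mul]
  rw [← integral_const_mul, ← integral_const_mul,
    ← integral_add ((hfin.conditional x hx b).const_mul s) ((hfin.conditional x hx c).const_mul t)]
  refine integral_mono (((hfin.conditional x hx b).const_mul s).add
    ((hfin.conditional x hx c).const_mul t)) (hfin.conditional x hx _) fun z => ?_
  have h1 := hM.concave.2 (Set.mem_univ (profit C α z b)) (Set.mem_univ (profit C α z c)) hs ht hst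
  have h2 := hM.increasing.monotone
    ((profit_concaveOn C hα0 z).2 (Set.mem_univ b) (Set.mem_univ c) hs ht hst)
  exact h1.trans h2

theorem tendsto_profit_atTop (C : Contract) {α : ℝ} (hα1 : α < 1) :
    Filter.Tendsto (fun x => profit C α x 0) Filter.atTop Filter.atTop := by
  refine Filter.tendsto_atTop_mono' _ (f₁ := fun x => (1 - α) * x) ?_
    (Filter.tendsto_id.const_mul_atTop (by linarith))
  filter_upwards [Filter.eventually_ge_atTop 0] with x hx
  cases C <;> simp only [profit, Contract.payment, sub_zero, max_eq_right hx] <;> linarith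

/-- As the price `-k` falls, profit tends to infinity for each value, so the utility truncated at `u
1` tends to `u 1 > 0`. The truncation supplies the bound needed for dominated convergence and lies
below the true utility. -/
theorem exists_winUtility_pos (hM : Model P X Y I f κ u) (hα0 : 0 ≤ α) (hα1 : α < 1)
    (hfin : FiniteUtilities P X Y I κ u C α) {x : Fin N → ℝ} (hx : x ∈ signalSpace N I) :
    ∃ b, 0 < winUtility κ u C α 0 x b := by
  have := hM.markov 0
  have hu1 : 0 < u 1 := by rw [← hM.normalized]; exact hM.increasing one_pos
  have hinteg : ∀ k : ℕ, Integrable (fun z => u (profit C α z (-k))) (κ 0 x) :=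
    fun k => hfin.conditional x hx _
  have hmin : ∀ k : ℕ, Integrable (fun z => min (u (profit C α z (-k))) (u 1)) (κ 0 x) :=
    fun k => (hinteg k).inf (integrable_const _)
  have hmono : ∀ (k : ℕ) (z : ℝ), u (profit C α z 0) ≤ u (profit C α z (-k)) := fun k z => by
    apply hM.increasing.monotone
    rw [profit_eq_sub C α z (-k)]
    exact (profit_strictMono C hα0 hα1 0).monotone (by simp)
  have hlim : Filter.Tendsto (fun k : ℕ => ∫ z, min (u (profit C α z (-k))) (u 1) ∂(κ 0 x))
      Filter.atTop (nhds (∫ _, u 1 ∂(κ 0 x))) := by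
    refine tendsto_integral_of_dominated_convergence
      (fun z => |u (profit C α z 0)| + u 1) (fun k => (hmin k).aestronglyMeasurable)
      ((hfin.conditional x hx 0).abs.add (integrable_const _)) (fun k => ?_) ?_
    · refine Filter.Eventually.of_forall fun z => ?_
      rw [Real.norm_eq_abs, abs_le]
      have := neg_abs_le (u (profit C α z 0))
      have := hmono k z
      have := abs_nonneg (u (profit C α z 0))
      constructor
      · apply le_min <;> linarith
      · exact (min_le_right _ _).trans (by linarith)
    · refine Filter.Eventually.of_forall fun z => tendsto_const_nhds.congr' ?_
      have ht : Filter.Tendsto (fun k : ℕ => profit C α (z + k) 0) Filter.atTop Filter.atTop :=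
        (tendsto_profit_atTop C hα1).comp
          (Filter.tendsto_atTop_add_const_left _ z tendsto_natCast_atTop_atTop)
      filter_upwards [ht.eventually_ge_atTop 1] with k hk
      rw [min_eq_right]
      apply hM.increasing.monotone
      rw [profit_eq_sub]
      simpa using hk
  have h1 : (0 : ℝ) < ∫ _, u 1 ∂(κ 0 x) := by simpa using hu1
  obtain ⟨k, hk⟩ := (hlim.eventually_const_lt h1).exists
  exact ⟨-k, hk.trans_le (integral_mono (hmin k) (hinteg k) fun z => min_le_left _ _)⟩

/-- A concave strictly decreasing function falls at least linearly: beyond `1` it stays below the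
line through its values at `0` and `1`. -/
theorem exists_winUtility_neg (hM : Model P X Y I f κ u) (hα0 : 0 ≤ α) (hα1 : α < 1)
    (hfin : FiniteUtilities P X Y I κ u C α) {x : Fin N → ℝ} (hx : x ∈ signalSpace N I) :
    ∃ b, winUtility κ u C α 0 x b < 0 := by
  have hanti := winUtility_strictAnti hM hα0 hα1 hfin hx
  have hconc := winUtility_concaveOn hM hα0 hfin hx
  set g := winUtility κ u C α 0 x
  have h10 : 0 < g 0 - g 1 := sub_pos.2 (hanti one_pos)
  -- With `t` the price less one, concavity gives `g (t + 1) ≤ g 1 - t * (g 0 - g 1)`. This `t`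
  -- makes the last term `|g 0| + (g 0 - g 1)`, which is enough for a negative value.
  refine ⟨|g 0| / (g 0 - g 1) + 1 + 1, ?_⟩
  set t := |g 0| / (g 0 - g 1) + 1 with ht
  have htpos : 0 < t := by positivity
  have hts : t * (g 0 - g 1) = |g 0| + (g 0 - g 1) := by
    rw [ht]; field_simp
  have ht1 : (0 : ℝ) < t + 1 := by linarith
  have h := hconc.2 (Set.mem_univ 0) (Set.mem_univ (t + 1))
    (div_nonneg htpos.le ht1.le) (one_div_nonneg.2 ht1.le) (by field_simp)
  simp only [smul_eq_mul, mul_zero, zero_add, one_div, inv_mul_cancel₀ ht1.ne'] at h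
  have h' : t * g 0 + g (t + 1) ≤ (t + 1) * g 1 := by
    have := mul_le_mul_of_nonneg_left h ht1.le
    have e : (t + 1) * (t / (t + 1) * g 0 + (t + 1)⁻¹ * g (t + 1)) = t * g 0 + g (t + 1) := by
      field_simp
    linarith
  have := le_abs_self (g 0)
  nlinarith

theorem existsUnique_winUtility_eq_zero (hM : Model P X Y I f κ u) (hα0 : 0 ≤ α) (hα1 : α < 1)
    (hfin : FiniteUtilities P X Y I κ u C α) {x : Fin N → ℝ} (hx : x ∈ signalSpace N I) :
    ∃! b, winUtility κ u C α 0 x b = 0 := by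
  obtain ⟨b, hb⟩ := exists_winUtility_pos hM hα0 hα1 hfin hx
  obtain ⟨c, hc⟩ := exists_winUtility_neg hM hα0 hα1 hfin hx
  -- A finite concave function on the line is continuous, so no limit theorem for integrals is
  -- needed here.
  have hcont : Continuous (winUtility κ u C α 0 x) :=
    continuousOn_univ.1 ((winUtility_concaveOn hM hα0 hfin hx).continuousOn isOpen_univ)
  obtain ⟨p, hp⟩ := mem_range_of_exists_le_of_exists_ge hcont ⟨c, hc.le⟩ ⟨b, hb.le⟩
  exact ⟨p, hp, fun p' hp' =>
    (winUtility_strictAnti hM hα0 hα1 hfin hx).injective (hp'.trans hp.symm)⟩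

theorem winUtility_indiffPrice (hM : Model P X Y I f κ u) (hα0 : 0 ≤ α) (hα1 : α < 1)
    (hfin : FiniteUtilities P X Y I κ u C α) {x : Fin N → ℝ} (hx : x ∈ signalSpace N I) :
    winUtility κ u C α 0 x (indiffPrice κ u C α x) = 0 :=
  Classical.epsilon_spec (existsUnique_winUtility_eq_zero hM hα0 hα1 hfin hx).exists

theorem indiffPrice_le_iff (hM : Model P X Y I f κ u) (hα0 : 0 ≤ α) (hα1 : α < 1)
    (hfin : FiniteUtilities P X Y I κ u C α) {x : Fin N → ℝ} (hx : x ∈ signalSpace N I) (b : ℝ) :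
    indiffPrice κ u C α x ≤ b ↔ winUtility κ u C α 0 x b ≤ 0 := by
  rw [← winUtility_indiffPrice hM hα0 hα1 hfin hx]
  exact (winUtility_strictAnti hM hα0 hα1 hfin hx).le_iff_ge.symm

theorem le_indiffPrice_iff (hM : Model P X Y I f κ u) (hα0 : 0 ≤ α) (hα1 : α < 1)
    (hfin : FiniteUtilities P X Y I κ u C α) {x : Fin N → ℝ} (hx : x ∈ signalSpace N I) (b : ℝ) :
    b ≤ indiffPrice κ u C α x ↔ 0 ≤ winUtility κ u C α 0 x b := by
  rw [← winUtility_indiffPrice hM hα0 hα1 hfin hx]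
  exact (winUtility_strictAnti hM hα0 hα1 hfin hx).le_iff_ge.symm

/-- What the analysis of the auction uses about the indifference price `w` of the first buyer and
the expected utility `V n y b` from winning. -/
structure IsPriceRule (I : Set ℝ) (w : (Fin N → ℝ) → ℝ) (V : Fin N → (Fin N → ℝ) → ℝ → ℝ) :
    Prop where
  mono : ∀ {x x'}, x ∈ signalSpace N I → x' ∈ signalSpace N I → x ≤ x' → w x ≤ w x'
  strict : ∀ {x x'}, x ∈ signalSpace N I → x' ∈ signalSpace N I → x ≤ x' → x 0 < x' 0 → w x < w x'
  symm : ∀ {x} (π : Equiv.Perm (Fin N)), x ∈ signalSpace N I → π 0 = 0 → w (x ∘ π) = w x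
  nonneg : ∀ {x} (n : Fin N) (b : ℝ), x ∈ signalSpace N I → b ≤ w (x ∘ Equiv.swap 0 n) → 0 ≤ V n x b
  nonpos : ∀ {x} (n : Fin N) (b : ℝ), x ∈ signalSpace N I → w (x ∘ Equiv.swap 0 n) ≤ b → V n x b ≤ 0

theorem comp_mem_signalSpace {N : ℕ} {I : Set ℝ} {x : Fin N → ℝ} (hx : x ∈ signalSpace N I) (g : Fin N → Fin N) :
    x ∘ g ∈ signalSpace N I := fun i => hx (g i)

/-- By the symmetry of the conditional laws, buyer `n` stands where buyer `0` would after exchanging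
their coordinates; all later facts about buyer `n` are reduced to buyer `0` in this way. -/
theorem winUtility_swap (hM : Model P X Y I f κ u) {x : Fin N → ℝ} (hx : x ∈ signalSpace N I)
    (n : Fin N) (b : ℝ) :
    winUtility κ u C α n x b = winUtility κ u C α 0 (x ∘ Equiv.swap 0 n) b := by
  have h := hM.cond_symm (Equiv.swap 0 n) 0 x hx
  rw [Equiv.swap_apply_left] at h
  simp only [winUtility, h]
  rfl

theorem isPriceRule_indiffPrice (hM : Model P X Y I f κ u) (hα0 : 0 ≤ α) (hα1 : α < 1)
    (hfin : FiniteUtilities P X Y I κ u C α) :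
    IsPriceRule I (indiffPrice κ u C α) (winUtility κ u C α) where
  mono {x x'} hx hx' h := by
    rw [le_indiffPrice_iff hM hα0 hα1 hfin hx', ← winUtility_indiffPrice hM hα0 hα1 hfin hx]
    exact (winUtility_mono hM hα0 hα1 hfin hx hx' h _).1
  strict {x x'} hx hx' h h0 := by
    rw [← not_le, indiffPrice_le_iff hM hα0 hα1 hfin hx', not_le,
      ← winUtility_indiffPrice hM hα0 hα1 hfin hx]
    exact (winUtility_mono hM hα0 hα1 hfin hx hx' h _).2 h0
  symm {x} π hx h := by
    have := hM.cond_symm π 0 x hx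
    rw [h] at this
    simp only [indiffPrice, winUtility, this]
    rfl
  nonneg {x} n b hx h := by
    rw [winUtility_swap hM hx,
      ← le_indiffPrice_iff hM hα0 hα1 hfin (comp_mem_signalSpace hx _)]
    exact h
  nonpos {x} n b hx h := by
    rw [winUtility_swap hM hx,
      ← indiffPrice_le_iff hM hα0 hα1 hfin (comp_mem_signalSpace hx _)]
    exact h

end IndifferencePrice

/-! ### Stacked signal vectors -/

theorem stack_apply (N : ℕ) (y : ℝ) (qs : List ℝ) (i : Fin N) :
    stack N y qs i =
      if (i : ℕ) < N - qs.length then y else qs.getD (i - (N - qs.length)) y := by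
  unfold stack
  split_ifs with h
  · rw [List.getD_append _ _ _ _ (by simpa using h)]
    simp [h]
  · rw [List.getD_append_right _ _ _ _ (by simpa using h)]
    simp

theorem getD_mem_of_lt {qs : List ℝ} {k : ℕ} (hk : k < qs.length) (d : ℝ) : qs.getD k d ∈ qs := by
  rw [List.getD_eq_getElem _ _ hk]
  exact List.getElem_mem hk

theorem stack_mem {N : ℕ} {I : Set ℝ} {y : ℝ} {qs : List ℝ} (hy : y ∈ I) (hqs : ∀ x ∈ qs, x ∈ I) :
    stack N y qs ∈ signalSpace N I := by
  intro i
  rw [stack_apply]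
  split_ifs
  · exact hy
  · by_cases hk : (i : ℕ) - (N - qs.length) < qs.length
    · exact hqs _ (getD_mem_of_lt hk y)
    · rwa [List.getD_eq_default _ _ (not_lt.1 hk)]

theorem stack_zero {N : ℕ} [NeZero N] (y : ℝ) {qs : List ℝ} (h : qs.length < N) :
    stack N y qs 0 = y := by
  rw [stack_apply, if_pos (by simpa using h)]

theorem stack_le_stack {N : ℕ} {y y' : ℝ} {qs : List ℝ} (h : qs.length ≤ N) (hy : y ≤ y') :
    stack N y qs ≤ stack N y' qs := by
  intro i
  rw [stack_apply, stack_apply]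
  split_ifs with hi
  · exact hy
  · have hk : (i : ℕ) - (N - qs.length) < qs.length := by omega
    rw [List.getD_eq_getElem _ _ hk, List.getD_eq_getElem _ _ hk]

theorem stack_cons_le {N : ℕ} {y a m : ℝ} {qs : List ℝ} (h : qs.length + 1 ≤ N) (hy : y ≤ m)
    (ha : a ≤ m) : stack N y (a :: qs) ≤ stack N m qs := by
  intro i
  rw [stack_apply, stack_apply, List.length_cons]
  -- The slot `N - (qs.length + 1)` holds `a` on the left and the last copy of `m` on the right.
  -- Earlier slots compare `y` with `m`; later ones hold the same entry of `qs`.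
  rcases lt_trichotomy (i : ℕ) (N - (qs.length + 1)) with hi | hi | hi
  · rw [if_pos hi, if_pos (by omega)]
    exact hy
  · rw [if_neg (by omega), if_pos (by omega), hi]
    simpa using ha
  · obtain ⟨k, hk⟩ : ∃ k, (i : ℕ) - (N - (qs.length + 1)) = k + 1 :=
      ⟨(i : ℕ) - (N - (qs.length + 1)) - 1, by omega⟩
    have hk' : (i : ℕ) - (N - qs.length) = k := by omega
    have hkl : k < qs.length := by omega
    rw [if_neg (by omega), if_neg (by omega), hk, hk', List.getD_cons_succ,
      List.getD_eq_getElem _ _ hkl, List.getD_eq_getElem _ _ hkl]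

/-- The last of the repeated entries may be counted as the head of the list. This makes bids
continuous across a drop-out: a buyer with the same signal as the one just gone does not change his
bid. -/
theorem stack_cons_self {N : ℕ} (y : ℝ) {qs : List ℝ} (h : qs.length + 1 ≤ N) :
    stack N y (y :: qs) = stack N y qs := by
  have : List.replicate (N - (y :: qs).length) y ++ y :: qs
      = List.replicate (N - qs.length) y ++ qs := by
    obtain ⟨k, hk⟩ : ∃ k, N - qs.length = k + 1 := ⟨N - qs.length - 1, by omega⟩
    have hk' : N - (y :: qs).length = k := by simp only [List.length_cons]; omega
    rw [hk, hk', List.replicate_succ']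
    simp
  funext i
  simp only [stack, this]

theorem map_stack {N : ℕ} (y : ℝ) {qs : List ℝ} (h : qs.length ≤ N) :
    (Finset.univ : Finset (Fin N)).val.map (stack N y qs)
      = Multiset.replicate (N - qs.length) y + (qs : Multiset ℝ) := by
  have hl : (List.replicate (N - qs.length) y ++ qs).length = N := by
    simp [h]
  have hof : List.ofFn (stack N y qs) = List.replicate (N - qs.length) y ++ qs := by
    refine List.ext_getElem (by simp [h]) fun i h1 h2 => ?_
    simp only [List.getElem_ofFn, stack]
    rw [List.getD_eq_getElem _ _ h2]
  rw [Fin.univ_val_map, hof, ← Multiset.coe_add, Multiset.coe_replicate]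

/-- Two signal vectors with the same first entry and the same entries up to order differ by a
permutation that fixes the first coordinate. -/
theorem exists_perm_fixing_zero {N : ℕ} [NeZero N] {x x' : Fin N → ℝ} (h0 : x 0 = x' 0)
    (h : (Finset.univ : Finset (Fin N)).val.map x = Finset.univ.val.map x') :
    ∃ π : Equiv.Perm (Fin N), π 0 = 0 ∧ x = x' ∘ π := by
  rw [Fin.univ_val_map, Fin.univ_val_map, Multiset.coe_eq_coe] at h
  -- Two sorted lists with the same entries are equal.
  have hs : x ∘ Tuple.sort x = x' ∘ Tuple.sort x' := by
    apply List.ofFn_injective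
    exact ((((Tuple.sort x).ofFn_comp_perm x).trans h).trans
      ((Tuple.sort x').ofFn_comp_perm x').symm).eq_of_pairwise'
      (Tuple.monotone_sort x).sortedLE_ofFn.pairwise (Tuple.monotone_sort x').sortedLE_ofFn.pairwise
  obtain ⟨π, hπ⟩ : ∃ π : Equiv.Perm (Fin N), ∀ i, x i = x' (π i) := by
    refine ⟨(Tuple.sort x).symm.trans (Tuple.sort x'), fun i => ?_⟩
    simpa using congrFun hs ((Tuple.sort x).symm i)
  -- The permutation obtained by sorting may move `0`. Exchanging `π 0` and `0` afterwards repairs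
  -- this and is harmless, since `x'` takes the same value at both.
  refine ⟨π.trans (Equiv.swap (π 0) 0), by simp, funext fun i => ?_⟩
  have h1 : x' (π 0) = x' 0 := by rw [← hπ, h0]
  simp only [Function.comp_apply, Equiv.trans_apply, hπ]
  by_cases hi : π i = π 0
  · rw [hi, Equiv.swap_apply_left, h1]
  · by_cases hiz : π i = 0
    · rw [hiz, Equiv.swap_apply_right, h1]
    · rw [Equiv.swap_apply_of_ne_of_ne hi hiz]

/-! ### Inferred signals and bids -/

theorem length_inferred (q : List ℝ → ℝ) (h : List ℝ) : (inferred q h).length = h.length := by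
  induction h with
  | nil => rfl
  | cons p h ih => simp [inferred, ih]

section Bids

variable {N : ℕ} [NeZero N] {I : Set ℝ} {w : (Fin N → ℝ) → ℝ} {V : Fin N → (Fin N → ℝ) → ℝ → ℝ}
  {q : List ℝ → ℝ}

theorem IsPriceRule.strictMonoOn_stack (R : IsPriceRule I w V) {qs : List ℝ} (hl : qs.length < N)
    (hqs : ∀ x ∈ qs, x ∈ I) : StrictMonoOn (fun b => w (stack N b qs)) I := by
  intro b hb c hc hbc
  refine R.strict (stack_mem hb hqs) (stack_mem hc hqs) (stack_le_stack hl.le hbc.le) ?_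
  rwa [stack_zero _ hl, stack_zero _ hl]

theorem IsPriceRule.eq_of_map_eq (R : IsPriceRule I w V) {x x' : Fin N → ℝ}
    (hx' : x' ∈ signalSpace N I) (h0 : x 0 = x' 0)
    (h : (Finset.univ : Finset (Fin N)).val.map x = Finset.univ.val.map x') : w x = w x' := by
  obtain ⟨π, hπ, rfl⟩ := exists_perm_fixing_zero h0 h
  exact R.symm π hx' hπ

theorem IsInference.inferred_mem {N : ℕ} {w : (Fin N → ℝ) → ℝ} (hq : IsInference w I q) (h : List ℝ) :
    ∀ x ∈ inferred q h, x ∈ I := by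
  induction h with
  | nil => simp [inferred]
  | cons p h ih =>
    intro x hx
    rcases List.mem_cons.1 hx with rfl | hx
    · exact hq.mem p h
    · exact ih x hx

theorem bid_strictMonoOn (R : IsPriceRule I w V) (hq : IsInference w I q) {h : List ℝ}
    (hl : h.length < N) : StrictMonoOn (fun y => bid w q y h) I :=
  R.strictMonoOn_stack (by rwa [length_inferred]) (hq.inferred_mem h)

/-- The true signal solves the defining equation, so `q` returns a solution, and strict monotonicity
of bids leaves only one. -/
theorem inference_bid (R : IsPriceRule I w V) (hq : IsInference w I q) {h : List ℝ}
    (hl : h.length + 2 ≤ N) {y : ℝ} (hy : y ∈ I) : q (bid w q y h :: h) = y :=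
  (bid_strictMonoOn R hq (by omega)).injOn (hq.mem _ _) hy
    (hq.solves (bid w q y h) h hl ⟨y, hy, rfl⟩)

theorem bid_cons_self (R : IsPriceRule I w V) (hq : IsInference w I q) {h : List ℝ}
    (hl : h.length + 2 ≤ N) {y : ℝ} (hy : y ∈ I) :
    bid w q y (bid w q y h :: h) = bid w q y h := by
  change w (stack N y (q (bid w q y h :: h) :: inferred q h)) = _
  rw [inference_bid R hq hl hy, stack_cons_self _ (by rw [length_inferred]; omega)]
  rfl

/-- After a drop-out the bids of buyers with higher signals are still at or above the clock, so no
one is forced out at once. A buyer with the departed signal would keep his bid, and bids increase in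
the signal. -/
theorem bid_le_bid_cons (R : IsPriceRule I w V) (hq : IsInference w I q) {h : List ℝ}
    (hl : h.length + 2 ≤ N) {y z : ℝ} (hy : y ∈ I) (hz : z ∈ I) (hyz : y ≤ z) :
    bid w q y h ≤ bid w q z (bid w q y h :: h) := by
  conv_lhs => rw [← bid_cons_self R hq hl hy]
  exact (bid_strictMonoOn R hq (by simp only [List.length_cons]; omega)).monotoneOn hy hz hyz

/-- Raising `z` and the newly inferred signal to their maximum gives a bid before the drop-out. Thus
a clock beyond all bids remains so, even if `p` is a price that no signal explains. -/
theorem bid_cons_le (R : IsPriceRule I w V) (hq : IsInference w I q) {h : List ℝ}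
    (hl : h.length + 2 ≤ N) {c : ℝ} (hc : ∀ z ∈ I, bid w q z h ≤ c) (p : ℝ) {z : ℝ} (hz : z ∈ I) :
    bid w q z (p :: h) ≤ c := by
  have hm : max z (q (p :: h)) ∈ I := by
    rcases max_choice z (q (p :: h)) with h' | h' <;> rw [h']
    exacts [hz, hq.mem p h]
  refine le_trans (R.mono (stack_mem hz (hq.inferred_mem (p :: h)))
    (stack_mem hm (hq.inferred_mem h)) ?_) (hc _ hm)
  exact stack_cons_le (by rw [length_inferred]; omega) (le_max_left _ _) (le_max_right _ _)

/-- By `bid_cons_self` the signal inferred from `p` still bids `p` after the drop-out, while the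
next inferred signal bids `p' ≥ p`; strictly increasing bids compare the two. -/
theorem inference_le_of_le (R : IsPriceRule I w V) (hq : IsInference w I q) {h : List ℝ} {p p' : ℝ}
    (hl : h.length + 3 ≤ N) (hp : p ≤ p') (hs : ∃ b ∈ I, SignalEq w q h p b)
    (hs' : ∃ b ∈ I, SignalEq w q (p :: h) p' b) : q (p :: h) ≤ q (p' :: p :: h) := by
  have e : bid w q (q (p :: h)) h = p := hq.solves p h (by omega) hs
  have e' : bid w q (q (p' :: p :: h)) (p :: h) = p' :=
    hq.solves p' (p :: h) (by simp only [List.length_cons]; omega) hs'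
  have e'' := bid_cons_self R hq (h := h) (by omega) (hq.mem p h)
  rw [e] at e''
  rw [← (bid_strictMonoOn R hq (h := p :: h)
    (by simp only [List.length_cons]; omega)).le_iff_le (hq.mem _ _) (hq.mem _ _)]
  exact (e''.trans_le hp).trans e'.ge

end Bids

/-! ### The first buyer to leave -/

section FirstOut

variable {N : ℕ} [NeZero N] {ρ : Equiv.Perm (Fin N)} {b : Fin N → ℝ} {D : Finset (Fin N)}

theorem firstOut_spec (ρ : Equiv.Perm (Fin N)) (b : Fin N → ℝ) (hD : D.Nonempty) :
    firstOut ρ b D ∈ D ∧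
      ∀ j ∈ D, b (firstOut ρ b D) < b j ∨ (b (firstOut ρ b D) = b j ∧ ρ (firstOut ρ b D) ≤ ρ j) := by
  refine Classical.epsilon_spec (p := fun i => i ∈ D ∧ ∀ j ∈ D, b i < b j ∨ (b i = b j ∧ ρ i ≤ ρ j)) ?_
  -- Exit price first, then priority: a minimum in the lexicographic order.
  obtain ⟨i, hi, hmin⟩ := D.exists_min_image (fun i => toLex (b i, ρ i)) hD
  exact ⟨i, hi, fun j hj => Prod.Lex.toLex_le_toLex.1 (hmin j hj)⟩

theorem firstOut_eq {i : Fin N} (hi : i ∈ D)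
    (hmin : ∀ j ∈ D, b i < b j ∨ (b i = b j ∧ ρ i ≤ ρ j)) : firstOut ρ b D = i := by
  obtain ⟨h1, h2⟩ := firstOut_spec ρ b ⟨i, hi⟩
  rcases hmin _ h1 with h | ⟨h, h'⟩ <;> rcases h2 i hi with k | ⟨k, k'⟩
  · exact absurd k h.not_gt
  · exact absurd k h.ne'
  · exact absurd h k.ne'
  · exact ρ.injective (le_antisymm k' h')

theorem firstOut_mem (ρ : Equiv.Perm (Fin N)) (b : Fin N → ℝ) (hD : D.Nonempty) :
    firstOut ρ b D ∈ D := (firstOut_spec ρ b hD).1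

theorem firstOut_le (ρ : Equiv.Perm (Fin N)) (b : Fin N → ℝ) {j : Fin N} (hj : j ∈ D) :
    b (firstOut ρ b D) ≤ b j :=
  ((firstOut_spec ρ b ⟨j, hj⟩).2 j hj).elim le_of_lt fun h => h.1.le

/-- The first buyer to leave depends only on the order of the exit prices. -/
theorem firstOut_congr {b' : Fin N → ℝ} (hD : D.Nonempty)
    (h : ∀ i ∈ D, ∀ j ∈ D, b i ≤ b j ↔ b' i ≤ b' j) : firstOut ρ b D = firstOut ρ b' D := by
  obtain ⟨h1, h2⟩ := firstOut_spec ρ b' hD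
  refine firstOut_eq h1 fun j hj => ?_
  have e1 := h _ h1 j hj
  have e2 := h j hj _ h1
  rcases h2 j hj with k | ⟨k, k'⟩
  · exact Or.inl (not_le.1 fun hk => k.not_ge (e2.1 hk))
  · exact Or.inr ⟨le_antisymm (e1.2 k.le) (e2.2 k.ge), k'⟩

theorem play_fst_mem (σ : Fin N → Strategy) (y : Fin N → ℝ) :
    ∀ (k : ℕ) (h : List ℝ) (c : EReal) (S : Finset (Fin N)), S.card = k + 1 →
      (play ρ σ y k h c S).1 ∈ S := by
  intro k
  induction k with
  | zero =>
    intro h c S hS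
    exact Classical.epsilon_spec (p := fun i => i ∈ S) (Finset.card_pos.1 (by omega))
  | succ k ih =>
    intro h c S hS
    have hi := firstOut_mem ρ (exitPrice σ y h c) (D := S) (Finset.card_pos.1 (by omega))
    exact Finset.mem_of_mem_erase
      (ih _ _ (S.erase _) (by rw [Finset.card_erase_of_mem hi, hS]; rfl))

/-- A buyer who drops out does not win. -/
theorem ne_firstOut_of_play_eq {σ : Fin N → Strategy} {y : Fin N → ℝ} {k : ℕ} {h : List ℝ}
    {c : EReal} {S : Finset (Fin N)} {n : Fin N} (hS : S.card = k + 2)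
    (hwin : (play ρ σ y (k + 1) h c S).1 = n) : firstOut ρ (exitPrice σ y h c) S ≠ n := by
  have hi := firstOut_mem ρ (exitPrice σ y h c) (D := S) (Finset.card_pos.1 (by omega))
  have := play_fst_mem (ρ := ρ) σ y k (exitPrice σ y h c (firstOut ρ (exitPrice σ y h c) S) :: h)
    (exitPrice σ y h c (firstOut ρ (exitPrice σ y h c) S) : EReal) (S.erase _)
    (by rw [Finset.card_erase_of_mem hi, hS]; rfl)
  intro hn
  change (play ρ σ y (k + 1) h c S).1 ∈ _ at this
  rw [hwin, ← hn] at this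
  exact Finset.notMem_erase _ _ this

end FirstOut

/-! ### Continuation of the auction against the candidate strategy -/

section Continuation

variable {N : ℕ} [NeZero N] {I : Set ℝ} {w : (Fin N → ℝ) → ℝ} {V : Fin N → (Fin N → ℝ) → ℝ → ℝ}
  {q : List ℝ → ℝ} {ρ : Equiv.Perm (Fin N)} {n : Fin N} {y : Fin N → ℝ} {S : Finset (Fin N)}
  {h : List ℝ} {c : EReal}

/-- The node `(y, S)` is consistent, for buyer `n`, with the drop-out prices `h` and the clock price
`c`: the inferred signals are the true ones, and no other active buyer should have left. -/
structure IsConsistent (w : (Fin N → ℝ) → ℝ) (I : Set ℝ) (q : List ℝ → ℝ) (n : Fin N)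
    (y : Fin N → ℝ) (S : Finset (Fin N)) (h : List ℝ) (c : EReal) : Prop where
  mem : y ∈ signalSpace N I
  active : n ∈ S
  card : S.card + h.length = N
  dropped : (Finset.univ \ S).val.map y = (inferred q h : Multiset ℝ)
  le_bid : ∀ j ∈ S, j ≠ n → c ≤ (bid w q (y j) h : ℝ)

/-- The profile in which buyer `n` uses `τ` and the others the candidate strategy. -/
abbrev deviate (w : (Fin N → ℝ) → ℝ) (q : List ℝ → ℝ) (n : Fin N) (τ : Strategy) :
    Fin N → Strategy := Function.update (fun _ => bid w q) n τ

theorem deviate_bid : deviate w q n (bid w q) = fun _ => bid w q :=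
  Function.update_eq_self n _

theorem deviate_self (τ : Strategy) : deviate w q n τ n = τ :=
  Function.update_self n _ _

theorem exitPrice_of_le {σ : Fin N → Strategy} {i : Fin N} (hle : c ≤ (σ i (y i) h : ℝ)) :
    exitPrice σ y h c i = σ i (y i) h := by
  rw [exitPrice, max_eq_right hle, EReal.toReal_coe]

theorem IsConsistent.exitPrice_eq (hc : IsConsistent w I q n y S h c) {σ : Fin N → Strategy}
    {j : Fin N} (hj : j ∈ S) (hjn : j ≠ n) (hσ : σ j = bid w q) :
    exitPrice σ y h c j = bid w q (y j) h := by
  rw [exitPrice_of_le (by rw [hσ]; exact hc.le_bid j hj hjn), hσ]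

theorem IsConsistent.length_add_two_le (hc : IsConsistent w I q n y S h c) {i : Fin N} (hi : i ∈ S)
    (hin : i ≠ n) : h.length + 2 ≤ N := by
  have h1 : 1 < S.card := Finset.one_lt_card.2 ⟨i, hi, n, hc.active, hin⟩
  have := hc.card
  omega

/-- Consistency survives the departure of the lowest rival: his price reveals his signal
(`inference_bid`), and the bids of the others do not fall below it (`bid_le_bid_cons`). -/
theorem IsConsistent.step (R : IsPriceRule I w V) (hq : IsInference w I q)
    (hc : IsConsistent w I q n y S h c) {i : Fin N} (hi : i ∈ S) (hin : i ≠ n)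
    (hmin : ∀ j ∈ S, j ≠ n → y i ≤ y j) :
    IsConsistent w I q n y (S.erase i) (bid w q (y i) h :: h) (bid w q (y i) h : ℝ) := by
  have hl := hc.length_add_two_le hi hin
  refine ⟨hc.mem, Finset.mem_erase.2 ⟨hin.symm, hc.active⟩, ?_, ?_, fun j hj hjn => ?_⟩
  · have := hc.card
    have h1 : 0 < S.card := Finset.card_pos.2 ⟨i, hi⟩
    rw [Finset.card_erase_of_mem hi, List.length_cons]
    omega
  · have e : Finset.univ \ S.erase i = insert i (Finset.univ \ S) := by
      ext j
      simp only [Finset.mem_sdiff, Finset.mem_univ, true_and, Finset.mem_erase, Finset.mem_insert]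
      tauto
    rw [e, Finset.insert_val_of_notMem (by simp [hi]), Multiset.map_cons, hc.dropped]
    simp [inferred, inference_bid R hq hl (hc.mem i)]
  · rw [EReal.coe_le_coe_iff]
    exact bid_le_bid_cons R hq hl (hc.mem i) (hc.mem j)
      (hmin j (Finset.mem_of_mem_erase hj) hjn)

/-- If the first buyer to leave is not `n`, he has the lowest signal of the active buyers other than
`n`, and leaves at his bid. -/
theorem IsConsistent.firstOut_ne (R : IsPriceRule I w V) (hq : IsInference w I q)
    (hc : IsConsistent w I q n y S h c) {τ : Strategy} {i : Fin N}
    (hi : i = firstOut ρ (exitPrice (deviate w q n τ) y h c) S) (hin : i ≠ n) :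
    i ∈ S ∧ (∀ j ∈ S, j ≠ n → y i ≤ y j) ∧
      exitPrice (deviate w q n τ) y h c i = bid w q (y i) h := by
  have hiS : i ∈ S := hi ▸ firstOut_mem ρ _ ⟨n, hc.active⟩
  have hl := hc.length_add_two_le hiS hin
  have hex : ∀ j ∈ S, j ≠ n → exitPrice (deviate w q n τ) y h c j = bid w q (y j) h :=
    fun j hj hjn => hc.exitPrice_eq hj hjn (by simp [hjn])
  refine ⟨hiS, fun j hj hjn => ?_, hex i hiS hin⟩
  have := firstOut_le ρ (exitPrice (deviate w q n τ) y h c) hj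
  rw [← hi, hex i hiS hin, hex j hj hjn] at this
  exact ((bid_strictMonoOn R hq (by omega)).le_iff_le (hc.mem i) (hc.mem j)).1 this

theorem play_succ (σ : Fin N → Strategy) (k : ℕ) {i : Fin N} {p : ℝ}
    (hi : firstOut ρ (exitPrice σ y h c) S = i) (hp : exitPrice σ y h c i = p) :
    play ρ σ y (k + 1) h c S = play ρ σ y k (p :: h) (p : EReal) (S.erase i) := by
  subst hi hp
  rfl

/-- The bid of the last other active buyer, when all others have been identified, is the price at
which buyer `n` would be indifferent if he had the same signal. -/
theorem IsConsistent.bid_last (R : IsPriceRule I w V) (hc : IsConsistent w I q n y S h c)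
    {i : Fin N} (hin : i ≠ n) (hS : S = {n, i}) :
    bid w q (y i) h = w (Function.update y n (y i) ∘ Equiv.swap 0 n) := by
  have hcard : S.card = 2 := by rw [hS, Finset.card_pair hin.symm]
  have hlen : (inferred q h).length = N - 2 := by
    rw [length_inferred]; have := hc.card; omega
  have hN : 2 ≤ N := by have := hc.card; omega
  have hx : Function.update y n (y i) ∈ signalSpace N I := fun j => by
    rcases eq_or_ne j n with rfl | hj
    · simpa using hc.mem i
    · simpa [hj] using hc.mem j
  -- Both vectors begin with `y i`, and up to order both consist of `y i` twice (once for `n`, once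
  -- for `i`) and the inferred signals of the departed.
  refine R.eq_of_map_eq (comp_mem_signalSpace hx _) ?_ ?_
  · rw [stack_zero _ (by omega)]
    simp
  · have e1 : (Finset.univ : Finset (Fin N)).val.map (Function.update y n (y i) ∘ Equiv.swap 0 n)
        = Finset.univ.val.map (Function.update y n (y i)) := by
      rw [← Multiset.map_map]
      congr 1
      have := Finset.map_univ_equiv (Equiv.swap 0 n)
      exact congrArg Finset.val this
    have e2 : (Finset.univ : Finset (Fin N)) = insert n (insert i (Finset.univ \ S)) := by
      rw [hS]
      ext j
      simp only [Finset.mem_univ, Finset.mem_insert, Finset.mem_sdiff, Finset.mem_singleton, true_and,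
        true_iff]
      tauto
    rw [map_stack _ (by omega), e1, e2, Finset.insert_val_of_notMem, Finset.insert_val_of_notMem,
      Multiset.map_cons, Multiset.map_cons, Function.update_self, Function.update_of_ne hin,
      Multiset.map_congr rfl (g := y), hc.dropped, hlen]
    · have : N - (N - 2) = 2 := by omega
      rw [this, Multiset.replicate_succ, Multiset.replicate_one, Multiset.cons_add,
        Multiset.singleton_add]
    · intro j hj
      have : j ≠ n := by
        rintro rfl
        exact (Finset.mem_sdiff.1 hj).2 hc.active
      rw [Function.update_of_ne this]
    · simp [hS]
    · simp [hS, hin.symm]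

/-- Whatever strategy buyer `n` uses, the price he pays if he wins depends only on the signals. -/
theorem IsConsistent.price_of_win (R : IsPriceRule I w V) (hq : IsInference w I q) {τ : Strategy} :
    ∀ (k : ℕ) {S : Finset (Fin N)} {h : List ℝ} {c : EReal}, IsConsistent w I q n y S h c →
      S.card = k + 2 → (play ρ (deviate w q n τ) y (k + 1) h c S).1 = n →
      ∃ i ∈ S, i ≠ n ∧ (∀ j ∈ S, j ≠ n → y j ≤ y i) ∧
        (play ρ (deviate w q n τ) y (k + 1) h c S).2
          = w (Function.update y n (y i) ∘ Equiv.swap 0 n) := by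
  intro k
  induction k with
  | zero =>
    intro S h c hc hS hwin
    have hin := ne_firstOut_of_play_eq hS hwin
    obtain ⟨hi, hmin, hp⟩ := hc.firstOut_ne R hq rfl hin
    set i := firstOut ρ (exitPrice (deviate w q n τ) y h c) S with hidef
    have hpair : S = {n, i} := by
      refine (Finset.eq_of_subset_of_card_le ?_ ?_).symm
      · simp [Finset.insert_subset_iff, hi, hc.active]
      · rw [hS, Finset.card_pair hin.symm]
    refine ⟨i, hi, hin, fun j hj hjn => ?_, ?_⟩
    · rw [hpair] at hj
      simp only [Finset.mem_insert, hjn, Finset.mem_singleton, false_or] at hj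
      rw [hj]
    · rw [play_succ _ 0 hidef.symm hp, ← hc.bid_last R hin hpair]
      simp [play]
  | succ k ih =>
    intro S h c hc hS hwin
    have hin := ne_firstOut_of_play_eq hS hwin
    obtain ⟨hi, hmin, hp⟩ := hc.firstOut_ne R hq rfl hin
    set i := firstOut ρ (exitPrice (deviate w q n τ) y h c) S with hidef
    rw [play_succ _ (k + 1) hidef.symm hp] at hwin ⊢
    obtain ⟨l, hl, hln, hmax, hpr⟩ := ih (hc.step R hq hi hin hmin)
      (by rw [Finset.card_erase_of_mem hi, hS]; rfl) hwin
    refine ⟨l, Finset.mem_of_mem_erase hl, hln, fun j hj hjn => ?_, hpr⟩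
    rcases eq_or_ne j i with rfl | hji
    · exact hmin l (Finset.mem_of_mem_erase hl) hln
    · exact hmax j (Finset.mem_erase.2 ⟨hji, hj⟩) hjn

/-- With the candidate strategy a buyer wins if his signal is the highest. -/
theorem IsConsistent.win_of_lt (R : IsPriceRule I w V) (hq : IsInference w I q) :
    ∀ (k : ℕ) {S : Finset (Fin N)} {h : List ℝ} {c : EReal}, IsConsistent w I q n y S h c →
      S.card = k + 1 → (∀ j ∈ S, j ≠ n → y j < y n) →
      (play ρ (deviate w q n (bid w q)) y k h c S).1 = n := by
  intro k
  induction k with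
  | zero =>
    intro S h c hc hS _
    obtain ⟨a, rfl⟩ := Finset.card_eq_one.1 hS
    rw [Finset.mem_singleton.1 hc.active]
    exact Finset.mem_singleton.1 (play_fst_mem _ y 0 h c {a} hS)
  | succ k ih =>
    intro S h c hc hS hlt
    have hin : firstOut ρ (exitPrice (deviate w q n (bid w q)) y h c) S ≠ n := by
      intro hn
      obtain ⟨j, hj, hjn⟩ := Finset.exists_mem_ne (s := S) (by omega) n
      have hl := hc.length_add_two_le hj hjn
      have h1 := firstOut_le ρ (exitPrice (deviate w q n (bid w q)) y h c) hj
      have hb : bid w q (y j) h < bid w q (y n) h :=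
        bid_strictMonoOn R hq (by omega) (hc.mem j) (hc.mem n) (hlt j hj hjn)
      rw [hn, hc.exitPrice_eq hj hjn (by simp [hjn]), exitPrice_of_le, deviate_self] at h1
      · exact absurd h1 hb.not_ge
      · rw [deviate_self]
        exact (hc.le_bid j hj hjn).trans (EReal.coe_le_coe_iff.2 hb.le)
    obtain ⟨hi, hmin, hp⟩ := hc.firstOut_ne R hq rfl hin
    set i := firstOut ρ (exitPrice (deviate w q n (bid w q)) y h c) S with hidef
    rw [play_succ _ k hidef.symm hp]
    exact ih (hc.step R hq hi hin hmin) (by rw [Finset.card_erase_of_mem hi, hS]; rfl)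
      fun j hj hjn => hlt j (Finset.mem_of_mem_erase hj) hjn

/-- With the candidate strategy a buyer wins only if his signal is the highest, provided that the
clock has not passed his bid or has not reached those of the others. -/
theorem IsConsistent.le_of_win (R : IsPriceRule I w V) (hq : IsInference w I q) :
    ∀ (k : ℕ) {S : Finset (Fin N)} {h : List ℝ} {c : EReal}, IsConsistent w I q n y S h c →
      S.card = k + 1 →
      (c ≤ (bid w q (y n) h : ℝ) ∨ ∀ j ∈ S, j ≠ n → c < (bid w q (y j) h : ℝ)) →
      (play ρ (deviate w q n (bid w q)) y k h c S).1 = n → ∀ j ∈ S, j ≠ n → y j ≤ y n := by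
  intro k
  induction k with
  | zero =>
    intro S h c hc hS _ _ j hj hjn
    exact absurd ((Finset.card_le_one.1 hS.le) j hj n hc.active) hjn
  | succ k ih =>
    intro S h c hc hS hor hwin
    have hin := ne_firstOut_of_play_eq hS hwin
    obtain ⟨hi, hmin, hp⟩ := hc.firstOut_ne R hq rfl hin
    have h1 := firstOut_le ρ (exitPrice (deviate w q n (bid w q)) y h c) hc.active
    set i := firstOut ρ (exitPrice (deviate w q n (bid w q)) y h c) S with hidef
    have hl := hc.length_add_two_le hi hin
    rw [hp] at h1
    have hb : bid w q (y i) h ≤ bid w q (y n) h := by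
      by_contra hlt
      rw [not_le] at hlt
      -- If his bid were below that of `i`, buyer `n` would have to leave strictly earlier.
      -- Strictness of the clock condition matters: if the clock had passed his bid and stood
      -- exactly at that of `i`, both would leave now and the priority could make `n` win.
      have hlt' : max c (bid w q (y n) h : ℝ) < (bid w q (y i) h : ℝ) := by
        rw [max_lt_iff, EReal.coe_lt_coe_iff]
        refine ⟨?_, hlt⟩
        rcases hor with h2 | h2
        · exact h2.trans_lt (EReal.coe_lt_coe_iff.2 hlt)
        · exact h2 i hi hin
      have hne : max c (bid w q (y n) h : ℝ) ≠ ⊥ :=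
        ne_bot_of_le_ne_bot (EReal.coe_ne_bot _) (le_max_right _ _)
      rw [exitPrice, deviate_self, ← EReal.coe_le_coe_iff,
        EReal.coe_toReal (ne_top_of_lt hlt') hne] at h1
      exact absurd h1 hlt'.not_ge
    have hyi : y i ≤ y n :=
      ((bid_strictMonoOn R hq (by omega)).le_iff_le (hc.mem i) (hc.mem n)).1 hb
    rw [play_succ _ k hidef.symm hp] at hwin
    have := ih (hc.step R hq hi hin hmin) (by rw [Finset.card_erase_of_mem hi, hS]; rfl)
      -- From the next drop-out on, the first alternative holds: his signal is at least that of the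
      -- departed, so the clock has not passed his new bid.
      (Or.inl (EReal.coe_le_coe_iff.2 (bid_le_bid_cons R hq hl (hc.mem i) (hc.mem n) hyi))) hwin
    intro j hj hjn
    rcases eq_or_ne j i with rfl | hji
    · exact hyi
    · exact this j (Finset.mem_erase.2 ⟨hji, hj⟩) hjn

/-- The price paid by buyer `n` if he wins and the highest signal of the others is `m`. -/
def finalPrice (w : (Fin N → ℝ) → ℝ) (n : Fin N) (y : Fin N → ℝ) (m : ℝ) : ℝ :=
  w (Function.update y n m ∘ Equiv.swap 0 n)

theorem IsConsistent.exists_card_eq (hc : IsConsistent w I q n y S h c) {i : Fin N}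
    (hi : i ∈ S) (hin : i ≠ n) : ∃ k, S.card = k + 2 := by
  have h1 : 1 < S.card := Finset.one_lt_card.2 ⟨i, hi, n, hc.active, hin⟩
  exact ⟨S.card - 2, by omega⟩

/-- The strategy enters only through the event of winning, since the price does not depend on it. -/
theorem IsConsistent.nodePayoff_deviate (R : IsPriceRule I w V) (hq : IsInference w I q)
    (hc : IsConsistent w I q n y S h c) {i : Fin N} (hi : i ∈ S) (hin : i ≠ n)
    (hmax : ∀ j ∈ S, j ≠ n → y j ≤ y i) (τ : Strategy) :
    nodePayoff V ρ (deviate w q n τ) n h c (y, S)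
      = if (play ρ (deviate w q n τ) y (S.card - 1) h c S).1 = n then
          V n y (finalPrice w n y (y i)) else 0 := by
  obtain ⟨k, hk⟩ := hc.exists_card_eq hi hin
  have hk' : S.card - 1 = k + 1 := by omega
  simp only [nodePayoff, hk']
  split_ifs with hwin
  · obtain ⟨l, hl, hln, hmaxl, hpr⟩ := hc.price_of_win R hq k hk hwin
    rw [hpr, le_antisymm (hmax l hl hln) (hmaxl i hi hin)]
    rfl
  · rfl

theorem update_mem_signalSpace (hy : y ∈ signalSpace N I) {a : ℝ} (ha : a ∈ I) :
    Function.update y n a ∈ signalSpace N I := fun j => by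
  rcases eq_or_ne j n with rfl | hj
  · simpa using ha
  · simpa [hj] using hy j

theorem update_comp_swap_le {x x' : Fin N → ℝ} (hx : x ≤ x') :
    x ∘ Equiv.swap 0 n ≤ x' ∘ Equiv.swap 0 n := fun j => hx (Equiv.swap 0 n j)

/-- The final price is the indifference price with the own signal replaced by the rival's. Lowering
the own signal lowers it, so it does not exceed the true indifference price. -/
theorem IsPriceRule.utility_finalPrice_nonneg (R : IsPriceRule I w V) (hy : y ∈ signalSpace N I)
    {i : Fin N} (hi : y i ≤ y n) : 0 ≤ V n y (finalPrice w n y (y i)) := by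
  refine R.nonneg n _ hy (R.mono (comp_mem_signalSpace (update_mem_signalSpace hy (hy i)) _)
    (comp_mem_signalSpace hy _) (update_comp_swap_le fun j => ?_))
  rcases eq_or_ne j n with rfl | hj
  · simpa using hi
  · simp [hj]

theorem IsPriceRule.utility_finalPrice_nonpos (R : IsPriceRule I w V) (hy : y ∈ signalSpace N I)
    {i : Fin N} (hi : y n ≤ y i) : V n y (finalPrice w n y (y i)) ≤ 0 := by
  refine R.nonpos n _ hy (R.mono (comp_mem_signalSpace hy _)
    (comp_mem_signalSpace (update_mem_signalSpace hy (hy i)) _) (update_comp_swap_le fun j => ?_))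
  rcases eq_or_ne j n with rfl | hj
  · simpa using hi
  · simp [hj]

/-- Winning implies that the utility is nonnegative and losing that it is nonpositive. Ties of
signals cause no trouble, since the utility then has both signs. -/
theorem IsConsistent.nodePayoff_bid (R : IsPriceRule I w V) (hq : IsInference w I q)
    (hc : IsConsistent w I q n y S h c) {i : Fin N} (hi : i ∈ S) (hin : i ≠ n)
    (hmax : ∀ j ∈ S, j ≠ n → y j ≤ y i)
    (hor : c ≤ (bid w q (y n) h : ℝ) ∨ ∀ j ∈ S, j ≠ n → c < (bid w q (y j) h : ℝ)) :
    nodePayoff V ρ (deviate w q n (bid w q)) n h c (y, S)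
      = max (V n y (finalPrice w n y (y i))) 0 := by
  rw [hc.nodePayoff_deviate R hq hi hin hmax]
  have hS : S.card = S.card - 1 + 1 := by
    have : 0 < S.card := Finset.card_pos.2 ⟨i, hi⟩
    omega
  split_ifs with hwin
  · exact (max_eq_left (R.utility_finalPrice_nonneg hc.mem
      (hc.le_of_win R hq _ hS hor hwin i hi hin))).symm
  · refine (max_eq_right (R.utility_finalPrice_nonpos hc.mem (not_lt.1 fun hlt => hwin ?_))).symm
    exact hc.win_of_lt R hq _ hS fun j hj hjn => (hmax j hj hjn).trans_lt hlt

/-- A deviation yields either the utility of winning or zero, and `bid` yields the larger of the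
two. The comparison holds at each node separately, hence under any belief on such nodes. -/
theorem IsConsistent.nodePayoff_le (R : IsPriceRule I w V) (hq : IsInference w I q)
    (hc : IsConsistent w I q n y S h c) (hS : 2 ≤ S.card)
    (hor : c ≤ (bid w q (y n) h : ℝ) ∨ ∀ j ∈ S, j ≠ n → c < (bid w q (y j) h : ℝ)) (τ : Strategy) :
    nodePayoff V ρ (deviate w q n τ) n h c (y, S)
      ≤ nodePayoff V ρ (deviate w q n (bid w q)) n h c (y, S) := by
  have hne : (S.erase n).Nonempty := Finset.card_pos.1 (by
    rw [Finset.card_erase_of_mem hc.active]; omega)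
  obtain ⟨i, hi, hmax⟩ := (S.erase n).exists_max_image y hne
  obtain ⟨hin, hi⟩ := Finset.mem_erase.1 hi
  have hmax' : ∀ j ∈ S, j ≠ n → y j ≤ y i := fun j hj hjn => hmax j (Finset.mem_erase.2 ⟨hjn, hj⟩)
  rw [hc.nodePayoff_bid R hq hi hin hmax' hor, hc.nodePayoff_deviate R hq hi hin hmax']
  split_ifs
  exacts [le_max_left _ _, le_max_right _ _]

/-! ### A clock beyond all bids -/

theorem exitPrice_of_bid_le {c : ℝ} {σ : Fin N → Strategy} {i : Fin N} (hle : σ i (y i) h ≤ c) :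
    exitPrice σ y h (c : EReal) i = c := by
  rw [exitPrice, max_eq_left (EReal.coe_le_coe_iff.2 hle), EReal.toReal_coe]

theorem le_exitPrice {c : ℝ} (σ : Fin N → Strategy) (i : Fin N) :
    c ≤ exitPrice σ y h (c : EReal) i := by
  rcases le_total c (σ i (y i) h) with hle | hle
  · rwa [exitPrice_of_le (EReal.coe_le_coe_iff.2 hle)]
  · rw [exitPrice_of_bid_le hle]

/-- If the clock is beyond all bids, everyone leaves at once: a winner pays the current price, and
buyer `n` cannot avoid winning when the candidate strategy makes him win. -/
theorem play_of_bids_le (R : IsPriceRule I w V) (hq : IsInference w I q)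
    (hy : y ∈ signalSpace N I) (τ : Strategy) {c : ℝ} :
    ∀ (k : ℕ) {S : Finset (Fin N)} {h : List ℝ}, n ∈ S → S.card = k + 1 → S.card + h.length = N →
      (∀ z ∈ I, bid w q z h ≤ c) →
      ((play ρ (deviate w q n τ) y k h c S).1 = n → (play ρ (deviate w q n τ) y k h c S).2 = c) ∧
      ((play ρ (deviate w q n (bid w q)) y k h c S).1 = n →
        (play ρ (deviate w q n τ) y k h c S).1 = n) := by
  intro k
  induction k with
  | zero =>
    intro S h _ _ _ _
    exact ⟨fun _ => by simp [play], id⟩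
  | succ k ih =>
    intro S h hn hS hcard hle
    have hex : ∀ (τ' : Strategy) (j : Fin N), j ≠ n →
        exitPrice (deviate w q n τ') y h (c : EReal) j = c :=
      fun τ' j hjn => exitPrice_of_bid_le (by simpa [hjn] using hle (y j) (hy j))
    have hstep : ∀ (τ' : Strategy) (i : Fin N), i ≠ n → i ∈ S →
        firstOut ρ (exitPrice (deviate w q n τ') y h c) S = i →
        play ρ (deviate w q n τ') y (k + 1) h c S
          = play ρ (deviate w q n τ') y k (c :: h) (c : ℝ) (S.erase i) :=
      fun τ' i hin hi hf => play_succ _ k hf (hex τ' i hin)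
    have hih : ∀ i ≠ n, i ∈ S → _ := fun i hin hi =>
      ih (S := S.erase i) (h := c :: h) (Finset.mem_erase.2 ⟨hin.symm, hn⟩)
        (by rw [Finset.card_erase_of_mem hi, hS]; rfl)
        (by rw [Finset.card_erase_of_mem hi, List.length_cons]; omega)
        fun z hz => bid_cons_le R hq (by omega) hle c hz
    refine ⟨fun hwin => ?_, fun hwin => ?_⟩
    · have hin := ne_firstOut_of_play_eq hS hwin
      have hi := firstOut_mem ρ (exitPrice (deviate w q n τ) y h c) ⟨n, hn⟩
      rw [hstep τ _ hin hi rfl] at hwin ⊢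
      exact (hih _ hin hi).1 hwin
    · have hin := ne_firstOut_of_play_eq hS hwin
      obtain ⟨hi, hmin⟩ := firstOut_spec ρ (exitPrice (deviate w q n (bid w q)) y h c) ⟨n, hn⟩
      rw [hstep _ _ hin hi rfl] at hwin
      set i := firstOut ρ (exitPrice (deviate w q n (bid w q)) y h c) S
      -- Under `bid` all exit prices equal `c`, so `i` was selected by priority alone. A deviation
      -- can only raise the exit price of `n`, and `i` remains first.
      have hfirst : firstOut ρ (exitPrice (deviate w q n τ) y h c) S = i := by
        refine firstOut_eq hi fun j hj => ?_
        have hρ : ρ i ≤ ρ j := by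
          rcases hmin j hj with h1 | h1
          · have hjc : exitPrice (deviate w q n (bid w q)) y h c j = c :=
              exitPrice_of_bid_le (by simpa [deviate_bid] using hle (y j) (hy j))
            rw [hex _ i hin, hjc] at h1
            exact absurd h1 (lt_irrefl _)
          · exact h1.2
        rw [hex τ i hin]
        rcases (le_exitPrice (y := y) (h := h) (c := c) (deviate w q n τ) j).lt_or_eq with h1 | h1
        · exact Or.inl h1
        · exact Or.inr ⟨h1, hρ⟩
      rw [hstep τ i hin hi hfirst]
      exact (hih i hin hi).2 hwin

/-- Every deviation wins whenever `bid` does, always at the price `c`; winning more often at a price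
with nonpositive utility cannot help. -/
theorem nodePayoff_le_of_bids_le (R : IsPriceRule I w V) (hq : IsInference w I q)
    (hy : y ∈ signalSpace N I) (τ : Strategy) {c : ℝ} (hn : n ∈ S) (hcard : S.card + h.length = N)
    (hle : ∀ z ∈ I, bid w q z h ≤ c) (hV : V n y c ≤ 0) :
    nodePayoff V ρ (deviate w q n τ) n h c (y, S)
      ≤ nodePayoff V ρ (deviate w q n (bid w q)) n h c (y, S) := by
  have hS : S.card = S.card - 1 + 1 := by
    have : 0 < S.card := Finset.card_pos.2 ⟨n, hn⟩
    omega
  obtain ⟨h1, h2⟩ := play_of_bids_le (ρ := ρ) R hq hy τ _ hn hS hcard hle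
  obtain ⟨h3, -⟩ := play_of_bids_le (ρ := ρ) R hq hy (bid w q) _ hn hS hcard hle
  simp only [nodePayoff]
  split_ifs with hw hw' hw'
  · rw [h1 hw, h3 hw']
  · rwa [h1 hw]
  · exact absurd (h2 hw') hw
  · exact le_rfl

end Continuation

section Nodes

variable {N : ℕ} [NeZero N] {I : Set ℝ} {w : (Fin N → ℝ) → ℝ} {V : Fin N → (Fin N → ℝ) → ℝ → ℝ}
  {q : List ℝ → ℝ} {ρ : Equiv.Perm (Fin N)} {n : Fin N} {y : Fin N → ℝ} {S : Finset (Fin N)}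
  {h : List ℝ} {c : EReal}

/-! ### Degenerate beliefs -/

/-- A node at which buyer `n` has the signal `a`, the other active buyers the signal `z`, and those
who have left the signals `qs`. -/
def pointNode (n : Fin N) (a z : ℝ) (qs : List ℝ) : Node N :=
  (Function.update (stack N z qs) 0 a ∘ Equiv.swap 0 n,
    (Finset.univ.filter fun i : Fin N => (i : ℕ) < N - qs.length).map (Equiv.swap 0 n).toEmbedding)

theorem pointNode_self (n : Fin N) (a z : ℝ) (qs : List ℝ) : (pointNode n a z qs).1 n = a := by
  simp [pointNode]

theorem pointNode_comp_swap (n : Fin N) (a z : ℝ) (qs : List ℝ) :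
    (pointNode n a z qs).1 ∘ Equiv.swap 0 n = Function.update (stack N z qs) 0 a := by
  funext i
  simp [pointNode]

theorem pointNode_mem {a z : ℝ} {qs : List ℝ} (ha : a ∈ I) (hz : z ∈ I) (hqs : ∀ x ∈ qs, x ∈ I) :
    (pointNode n a z qs).1 ∈ signalSpace N I :=
  comp_mem_signalSpace (update_mem_signalSpace (stack_mem hz hqs) ha) _

theorem card_filter_val_lt {k : ℕ} (hk : k ≤ N) :
    (Finset.univ.filter fun i : Fin N => (i : ℕ) < k).card = k := by
  rw [Fin.card_filter_val_lt, min_eq_right hk]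

theorem pointNode_card (a z : ℝ) {qs : List ℝ} (hl : qs.length ≤ N) :
    (pointNode n a z qs).2.card + qs.length = N := by
  rw [pointNode, Finset.card_map, card_filter_val_lt (Nat.sub_le _ _)]
  omega

theorem pointNode_active (a z : ℝ) {qs : List ℝ} (hl : qs.length < N) :
    n ∈ (pointNode n a z qs).2 := by
  simp only [pointNode, Finset.mem_map_equiv, Equiv.symm_swap, Equiv.swap_apply_right,
    Finset.mem_filter, Finset.mem_univ, true_and, Fin.val_zero]
  omega

theorem pointNode_other (a z : ℝ) {qs : List ℝ} {j : Fin N} (hj : j ∈ (pointNode n a z qs).2)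
    (hjn : j ≠ n) : (pointNode n a z qs).1 j = z := by
  simp only [pointNode, Finset.mem_map_equiv, Equiv.symm_swap, Finset.mem_filter, Finset.mem_univ,
    true_and] at hj
  have h0 : Equiv.swap 0 n j ≠ 0 := fun h => hjn (by
    rw [← Equiv.swap_apply_self 0 n j, h, Equiv.swap_apply_left])
  simp only [pointNode, Function.comp_apply, Function.update_of_ne h0, stack_apply, if_pos hj]

theorem pointNode_dropped (a z : ℝ) {qs : List ℝ} (hl : qs.length < N) :
    (Finset.univ \ (pointNode n a z qs).2).val.map (pointNode n a z qs).1 = (qs : Multiset ℝ) := by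
  set F := Finset.univ.filter fun i : Fin N => (i : ℕ) < N - qs.length with hF
  have h1 : Finset.univ \ (pointNode n a z qs).2
      = (Finset.univ \ F).map (Equiv.swap 0 n).toEmbedding := by
    rw [Finset.map_sdiff, Finset.map_univ_equiv]
    rfl
  have h2 : (Finset.univ \ (pointNode n a z qs).2).val.map (pointNode n a z qs).1
      = (Finset.univ \ F).val.map (stack N z qs) := by
    rw [h1, Finset.map_val, Multiset.map_map]
    refine Multiset.map_congr rfl fun i hi => ?_
    have hi0 : i ≠ 0 := by
      rintro rfl
      rw [Finset.mem_val, Finset.mem_sdiff] at hi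
      refine hi.2 (Finset.mem_filter.2 ⟨Finset.mem_univ _, ?_⟩)
      simp only [Fin.val_zero]
      omega
    simp [pointNode, hi0]
  have h3 : F.val.map (stack N z qs) = Multiset.replicate (N - qs.length) z := by
    rw [Multiset.eq_replicate]
    refine ⟨by rw [Multiset.card_map]; exact card_filter_val_lt (Nat.sub_le _ _), fun b hb => ?_⟩
    obtain ⟨i, hi, rfl⟩ := Multiset.mem_map.1 hb
    rw [Finset.mem_val, hF, Finset.mem_filter] at hi
    rw [stack_apply, if_pos hi.2]
  -- `map_stack` counts the entries over all buyers; the first block contributes the copies of `z`,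
  -- and cancelling them leaves `qs`.
  have h4 := map_stack z hl.le
  have h5 : (Finset.univ : Finset (Fin N)).val = F.val + (Finset.univ \ F).val := by
    rw [Finset.sdiff_val, add_tsub_cancel_of_le (Finset.val_le_iff.2 (Finset.subset_univ F))]
  rw [h5, Multiset.map_add, h3] at h4
  rw [h2]
  exact add_left_cancel h4

theorem pointNode_isConsistent (hq : IsInference w I q) {a z : ℝ} (ha : a ∈ I) (hz : z ∈ I)
    (hl : h.length < N) (hle : c ≤ (bid w q z h : ℝ)) :
    IsConsistent w I q n (pointNode n a z (inferred q h)).1 (pointNode n a z (inferred q h)).2 h c where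
  mem := pointNode_mem ha hz (hq.inferred_mem h)
  active := pointNode_active a z (by rwa [length_inferred])
  card := by
    have := pointNode_card (n := n) a z (qs := inferred q h) (by rw [length_inferred]; exact hl.le)
    rwa [length_inferred] at this
  dropped := pointNode_dropped a z (by rwa [length_inferred])
  le_bid j hj hjn := by rwa [pointNode_other a z hj hjn]

/-- At every information set there is a node, at which those who have left have the inferred
signals, such that the candidate strategy is optimal given that node. -/
theorem exists_node_nodePayoff_le (R : IsPriceRule I w V) (hq : IsInference w I q)
    (ρ : Equiv.Perm (Fin N)) (n : Fin N) {a : ℝ} (hi : IsInfoSet N I a h c) :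
    ∃ d : Node N, (d.1 ∈ signalSpace N I ∧ d.1 n = a ∧ n ∈ d.2 ∧ d.2.card + h.length = N) ∧
      (Finset.univ \ d.2).val.map d.1 = (inferred q h : Multiset ℝ) ∧
      ∀ τ : Strategy, nodePayoff V ρ (deviate w q n τ) n h c d
        ≤ nodePayoff V ρ (deviate w q n (bid w q)) n h c d := by
  have hl2 := hi.length_le
  have hl : h.length < N := by omega
  have hql : (inferred q h).length < N := by rwa [length_inferred]
  have ha := hi.signal_mem
  have key : ∀ z ∈ I, (∀ τ : Strategy,
      nodePayoff V ρ (deviate w q n τ) n h c (pointNode n a z (inferred q h))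
        ≤ nodePayoff V ρ (deviate w q n (bid w q)) n h c (pointNode n a z (inferred q h))) →
      ∃ d : Node N, (d.1 ∈ signalSpace N I ∧ d.1 n = a ∧ n ∈ d.2 ∧ d.2.card + h.length = N) ∧
      (Finset.univ \ d.2).val.map d.1 = (inferred q h : Multiset ℝ) ∧
      ∀ τ : Strategy, nodePayoff V ρ (deviate w q n τ) n h c d
        ≤ nodePayoff V ρ (deviate w q n (bid w q)) n h c d := fun z hz hopt =>
    ⟨pointNode n a z (inferred q h), ⟨pointNode_mem ha hz (hq.inferred_mem h), pointNode_self _ _ _ _,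
      pointNode_active a z hql, by
        have := pointNode_card (n := n) a z hql.le
        rwa [length_inferred] at this⟩, pointNode_dropped a z hql, hopt⟩
  have hcons : ∀ z ∈ I, c < (bid w q z h : ℝ) → ∃ d : Node N, _ := fun z hz hlt =>
    key z hz fun τ => by
      have hc := pointNode_isConsistent (n := n) hq ha hz hl hlt.le
      refine hc.nodePayoff_le R hq ?_ (Or.inr fun j hj hjn => ?_) τ
      · have := hc.card
        omega
      · rwa [pointNode_other a z hj hjn]
  -- If some signal bids strictly above the clock, the active rivals are given that signal and the
  -- node is consistent. Otherwise they are given the own signal `a`: the indifference price at that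
  -- node is the own bid, which is at most the clock price, so winning there is not worthwhile.
  by_cases hex : ∃ z ∈ I, c < (bid w q z h : ℝ)
  · obtain ⟨z, hz, hlt⟩ := hex
    exact hcons z hz hlt
  · push Not at hex
    have hbot : c ≠ ⊥ := ne_bot_of_le_ne_bot (EReal.coe_ne_bot _) (hex a ha)
    obtain ⟨p, rfl⟩ : ∃ p : ℝ, (p : EReal) = c := ⟨c.toReal, EReal.coe_toReal hi.lt_top.ne hbot⟩
    refine key a ha fun τ => ?_
    have hcard := pointNode_card (n := n) a a hql.le
    rw [length_inferred] at hcard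
    refine nodePayoff_le_of_bids_le R hq (pointNode_mem ha ha (hq.inferred_mem h)) τ
      (pointNode_active a a hql) hcard (fun z hz => EReal.coe_le_coe_iff.1 (hex z hz))
      (R.nonpos n p (pointNode_mem ha ha (hq.inferred_mem h)) ?_)
    rw [pointNode_comp_swap]
    have : Function.update (stack N a (inferred q h)) 0 a = stack N a (inferred q h) := by
      rw [Function.update_eq_iff]
      exact ⟨(stack_zero a hql).symm, fun _ _ => rfl⟩
    rw [this]
    exact EReal.coe_le_coe_iff.1 (hex a ha)

/-! ### The path of the auction while a buyer stays in -/

/-- Signals of the buyers who have left and set of active buyers after `m` drop-outs, if the buyers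
other than `n` leave in the order of their signals. -/
noncomputable def orderPath (ρ : Equiv.Perm (Fin N)) (n : Fin N) (y : Fin N → ℝ) : ℕ → List ℝ × Finset (Fin N)
  | 0 => ([], Finset.univ)
  | m + 1 =>
    let s := orderPath ρ n y m
    let i := firstOut ρ y (s.2.erase n)
    (y i :: s.1, s.2.erase i)

/-- The `(m + 1)`-st drop-out price, if the buyers other than `n` leave in the order of their
signals. -/
noncomputable def nextPrice (w : (Fin N → ℝ) → ℝ) (ρ : Equiv.Perm (Fin N)) (n : Fin N) (m : ℕ) (y : Fin N → ℝ) :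
    ℝ :=
  w (stack N (y (firstOut ρ y ((orderPath ρ n y m).2.erase n))) (orderPath ρ n y m).1)

/-- The first `m` drop-out prices, most recent first. -/
noncomputable def pricePath (w : (Fin N → ℝ) → ℝ) (ρ : Equiv.Perm (Fin N)) (n : Fin N) (y : Fin N → ℝ) :
    ℕ → List ℝ
  | 0 => []
  | m + 1 => nextPrice w ρ n m y :: pricePath w ρ n y m

theorem length_pricePath (w : (Fin N → ℝ) → ℝ) (ρ : Equiv.Perm (Fin N)) (n : Fin N) (y : Fin N → ℝ)
    (m : ℕ) : (pricePath w ρ n y m).length = m := by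
  induction m with
  | zero => rfl
  | succ m ih => simp [pricePath, ih]

/-- While the others use the candidate strategy they leave in the order of their signals. -/
structure IsOnPath (w : (Fin N → ℝ) → ℝ) (I : Set ℝ) (q : List ℝ → ℝ) (ρ : Equiv.Perm (Fin N))
    (n : Fin N) (y : Fin N → ℝ) (m : ℕ) : Prop where
  prices : (pathStaying ρ (fun _ => bid w q) y n m).1 = pricePath w ρ n y m
  active : (pathStaying ρ (fun _ => bid w q) y n m).2 = (orderPath ρ n y m).2
  inferred_eq : inferred q (pricePath w ρ n y m) = (orderPath ρ n y m).1
  consistent : IsConsistent w I q n y (orderPath ρ n y m).2 (pricePath w ρ n y m)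
    (clock (pricePath w ρ n y m))
  ordered : ∀ d ∉ (orderPath ρ n y m).2, ∀ j ∈ (orderPath ρ n y m).2, j ≠ n → y d ≤ y j

/-- The next other buyer to leave is the one with the lowest signal. -/
theorem IsConsistent.firstOut_erase (R : IsPriceRule I w V) (hq : IsInference w I q)
    (hc : IsConsistent w I q n y S h c) {σ : Fin N → Strategy} (hσ : ∀ j, j ≠ n → σ j = bid w q)
    (hS : 2 ≤ S.card) :
    firstOut ρ (exitPrice σ y h c) (S.erase n) = firstOut ρ y (S.erase n) := by
  refine firstOut_congr (Finset.card_pos.1 ?_) fun i hi j hj => ?_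
  · rw [Finset.card_erase_of_mem hc.active]; omega
  · obtain ⟨hin, hi⟩ := Finset.mem_erase.1 hi
    obtain ⟨hjn, hj⟩ := Finset.mem_erase.1 hj
    rw [hc.exitPrice_eq hi hin (hσ i hin), hc.exitPrice_eq hj hjn (hσ j hjn)]
    exact (bid_strictMonoOn R hq (by have := hc.length_add_two_le hi hin; omega)).le_iff_le
      (hc.mem i) (hc.mem j)

/-- Induction on the number of drop-outs, with consistency as the invariant. The gain is that prices
and inferred signals on the path become functions of the signals that no longer mention `q`. -/
theorem isOnPath (R : IsPriceRule I w V) (hq : IsInference w I q) (ρ : Equiv.Perm (Fin N))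
    (n : Fin N) (hy : y ∈ signalSpace N I) (m : ℕ) (hm : m + 1 ≤ N) : IsOnPath w I q ρ n y m := by
  induction m with
  | zero =>
    exact ⟨rfl, rfl, rfl, ⟨hy, Finset.mem_univ n, by simp [orderPath, pricePath],
      by simp [orderPath, pricePath, inferred], fun _ _ _ => bot_le⟩,
      fun d hd => absurd (Finset.mem_univ d) hd⟩
  | succ m ih =>
    obtain ⟨hprices, hactive, hinf, hc, hordered⟩ := ih (by omega)
    have hcard := hc.card
    rw [length_pricePath] at hcard
    have hnext : nextPrice w ρ n m y = w (stack N (y (firstOut ρ y ((orderPath ρ n y m).2.erase n)))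
      (orderPath ρ n y m).1) := rfl
    have hprice : pricePath w ρ n y (m + 1) = nextPrice w ρ n m y :: pricePath w ρ n y m := rfl
    have hord : orderPath ρ n y (m + 1)
        = (y (firstOut ρ y ((orderPath ρ n y m).2.erase n)) :: (orderPath ρ n y m).1,
          (orderPath ρ n y m).2.erase (firstOut ρ y ((orderPath ρ n y m).2.erase n))) := rfl
    set S := (orderPath ρ n y m).2 with hSdef
    set h := pricePath w ρ n y m with hhdef
    have hne : (S.erase n).Nonempty := Finset.card_pos.1 (by
      rw [Finset.card_erase_of_mem hc.active]; omega)
    have hfirst := hc.firstOut_erase (ρ := ρ) R hq (σ := fun _ => bid w q)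
      (fun _ _ => rfl) (by omega)
    have hi := firstOut_mem ρ y hne
    have hmin : ∀ j ∈ S, j ≠ n → y (firstOut ρ y (S.erase n)) ≤ y j :=
      fun j hj hjn => firstOut_le ρ y (Finset.mem_erase.2 ⟨hjn, hj⟩)
    set i := firstOut ρ y (S.erase n) with hidef
    obtain ⟨hin, hiS⟩ := Finset.mem_erase.1 hi
    have hbid : bid w q (y i) h = nextPrice w ρ n m y := by
      rw [hnext, ← hinf]
      rfl
    have hpath : pathStaying ρ (fun _ => bid w q) y n (m + 1)
        = (nextPrice w ρ n m y :: h, S.erase i) := by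
      simp only [pathStaying, hprices, hactive, hfirst]
      rw [hc.exitPrice_eq hiS hin rfl, hbid]
    have hstep := hc.step R hq hiS hin hmin
    rw [hbid] at hstep
    have hl := hc.length_add_two_le hiS hin
    refine ⟨?_, ?_, ?_, ?_, ?_⟩
    · rw [hpath, hprice]
    · rw [hpath, hord]
    · rw [hprice, hord]
      simp only [inferred, hinf]
      rw [← hbid, inference_bid R hq hl (hy i)]
    · rw [hprice, hord]
      exact hstep
    · rw [hord]
      intro d hd j hj hjn
      have hjS := Finset.mem_of_mem_erase hj
      by_cases hdS : d ∈ S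
      · have : d = i := by
          by_contra hdi
          exact hd (Finset.mem_erase.2 ⟨hdi, hdS⟩)
        rw [this]
        exact hmin j hjS hjn
      · exact hordered d hdS j hjS hjn

/-- Before the next drop-out the clock price is below the bids of the other active buyers. -/
theorem IsOnPath.lt_bid (R : IsPriceRule I w V) (hq : IsInference w I q) {m : ℕ}
    (hp : IsOnPath w I q ρ n y m) (hlt : c < (nextPrice w ρ n m y : ℝ)) {j : Fin N}
    (hj : j ∈ (orderPath ρ n y m).2) (hjn : j ≠ n) :
    c < (bid w q (y j) (pricePath w ρ n y m) : ℝ) := by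
  refine hlt.trans_le (EReal.coe_le_coe_iff.2 ?_)
  have hl := hp.consistent.length_add_two_le hj hjn
  have hj' := Finset.mem_erase.2 ⟨hjn, hj⟩
  rw [nextPrice, ← hp.inferred_eq]
  exact (bid_strictMonoOn R hq (by omega)).monotoneOn (hp.consistent.mem _) (hp.consistent.mem j)
    (firstOut_le ρ y hj')

theorem IsOnPath.isConsistent_of_lt (R : IsPriceRule I w V) (hq : IsInference w I q) {m : ℕ}
    (hp : IsOnPath w I q ρ n y m) (hlt : c < (nextPrice w ρ n m y : ℝ)) :
    IsConsistent w I q n y (orderPath ρ n y m).2 (pricePath w ρ n y m) c :=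
  { hp.consistent with le_bid := fun _ hj hjn => (hp.lt_bid R hq hlt hj hjn).le }

/-- The highest signal of the buyers other than `n`. -/
noncomputable def topOther (n : Fin N) (y : Fin N → ℝ) : ℝ := ⨆ j : {j : Fin N // j ≠ n}, y j

/-- One of the other active buyers has the highest signal of all buyers other than `n`. -/
theorem IsOnPath.exists_topOther {m : ℕ} (hm : m + 2 ≤ N) (hp : IsOnPath w I q ρ n y m) :
    ∃ i ∈ (orderPath ρ n y m).2, i ≠ n ∧ (∀ j ∈ (orderPath ρ n y m).2, j ≠ n → y j ≤ y i) ∧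
      y i = topOther n y := by
  have hcard := hp.consistent.card
  rw [length_pricePath] at hcard
  have hne : ((orderPath ρ n y m).2.erase n).Nonempty := Finset.card_pos.1 (by
    rw [Finset.card_erase_of_mem hp.consistent.active]; omega)
  obtain ⟨i, hi, hmax⟩ := ((orderPath ρ n y m).2.erase n).exists_max_image y hne
  obtain ⟨hin, hi⟩ := Finset.mem_erase.1 hi
  have hmax' : ∀ j ∈ (orderPath ρ n y m).2, j ≠ n → y j ≤ y i :=
    fun j hj hjn => hmax j (Finset.mem_erase.2 ⟨hjn, hj⟩)
  refine ⟨i, hi, hin, hmax', le_antisymm ?_ ?_⟩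
  · exact le_ciSup (f := fun j : {j : Fin N // j ≠ n} => y j) (Set.finite_range _).bddAbove ⟨i, hin⟩
  · have : Nonempty {j : Fin N // j ≠ n} := ⟨⟨i, hin⟩⟩
    refine ciSup_le fun ⟨j, hjn⟩ => ?_
    by_cases hj : j ∈ (orderPath ρ n y m).2
    · exact hmax' j hj hjn
    · exact hp.ordered j hj i hi hin

end Nodes

/-! ### Measurability of the path of the auction -/

section Measurability

variable {E : Type*} [MeasurableSpace E]

/-- A list-valued map with values of length `m` and measurable entries. -/
structure MeasurableList (m : ℕ) (L : E → List ℝ) : Prop where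
  length_eq : ∀ x, (L x).length = m
  measurable_getD : ∀ j, Measurable fun x => (L x).getD j 0

theorem MeasurableList.const (l : List ℝ) : MeasurableList l.length fun _ : E => l :=
  ⟨fun _ => rfl, fun _ => measurable_const⟩

theorem MeasurableList.cons {m : ℕ} {L : E → List ℝ} (hL : MeasurableList m L) {g : E → ℝ}
    (hg : Measurable g) : MeasurableList (m + 1) fun x => g x :: L x := by
  refine ⟨fun x => by simp [hL.length_eq], fun j => ?_⟩
  cases j with
  | zero => simpa using hg
  | succ j => simpa using hL.measurable_getD j

theorem ofFn_getD {m : ℕ} {l : List ℝ} (hl : l.length = m) :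
    (List.ofFn fun j : Fin m => l.getD j 0) = l := by
  subst hl
  refine List.ext_getElem (by simp) fun i h1 h2 => ?_
  simp

/-- Measurability of a strategy is defined on tuples of fixed length, so a list of constant length
is routed through its tuple of entries. -/
theorem MeasurableList.measurable_strategy {m : ℕ} {L : E → List ℝ} (hL : MeasurableList m L)
    {τ : Strategy} (hτ : τ.IsMeasurable) {g : E → ℝ} (hg : Measurable g) :
    Measurable fun x => τ (g x) (L x) := by
  have h : (fun x => τ (g x) (L x)) = (fun z : ℝ × (Fin m → ℝ) => τ z.1 (List.ofFn z.2)) ∘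
      fun x => (g x, fun j : Fin m => (L x).getD j 0) := by
    funext x
    simp only [Function.comp_apply, ofFn_getD (hL.length_eq x)]
  rw [h]
  exact (hτ m).comp (hg.prodMk (measurable_pi_lambda _ fun j => hL.measurable_getD j))

variable {N : ℕ} [NeZero N]

theorem MeasurableList.measurable_stack {m : ℕ} {L : E → List ℝ} (hL : MeasurableList m L)
    {g : E → ℝ} (hg : Measurable g) : Measurable fun x => stack N (g x) (L x) := by
  refine measurable_pi_lambda _ fun i => ?_
  simp only [stack_apply, hL.length_eq]
  split_ifs with hi
  · exact hg
  · by_cases hlt : (i : ℕ) - (N - m) < m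
    · have : ∀ x, (L x).getD (i - (N - m)) (g x) = (L x).getD (i - (N - m)) 0 := fun x => by
        rw [← hL.length_eq x] at hlt
        simp only [← hL.length_eq x, List.getD_eq_getElem _ _ hlt]
      simp only [this]
      exact hL.measurable_getD _
    · have : ∀ x, (L x).getD (i - (N - m)) (g x) = g x := fun x =>
        List.getD_eq_default _ _ (by rw [hL.length_eq]; exact not_lt.1 hlt)
      simpa only [this] using hg

theorem measurable_firstOut (ρ : Equiv.Perm (Fin N)) (D : Finset (Fin N)) :
    Measurable fun y : Fin N → ℝ => firstOut ρ y D := by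
  rcases D.eq_empty_or_nonempty with rfl | hD
  · simp only [firstOut, Finset.notMem_empty, false_and]
    exact measurable_const
  · refine measurable_to_countable' fun i => ?_
    -- Each fibre is cut out by finitely many comparisons of coordinates.
    have : (fun y : Fin N → ℝ => firstOut ρ y D) ⁻¹' {i}
        = {y | i ∈ D ∧ ∀ j ∈ D, y i < y j ∨ (y i = y j ∧ ρ i ≤ ρ j)} := by
      ext y
      simp only [Set.mem_preimage, Set.mem_singleton_iff, Set.mem_ofPred_eq]
      refine ⟨?_, fun h => firstOut_eq h.1 h.2⟩
      rintro rfl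
      exact firstOut_spec ρ y hD
    rw [this]
    measurability

theorem measurable_firstOut_comp (ρ : Equiv.Perm (Fin N)) {g : E → Fin N → ℝ} (hg : Measurable g)
    {D : E → Finset (Fin N)} (hD : Measurable D) : Measurable fun x => firstOut ρ (g x) (D x) := by
  have : Measurable fun z : (Fin N → ℝ) × Finset (Fin N) => firstOut ρ z.1 z.2 :=
    measurable_from_prod_countable_left fun D => measurable_firstOut ρ D
  exact this.comp (hg.prodMk hD)

theorem measurable_apply_comp {g : E → Fin N → ℝ} (hg : Measurable g) {i : E → Fin N}
    (hi : Measurable i) : Measurable fun x => g x (i x) := by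
  have : Measurable fun z : (Fin N → ℝ) × Fin N => z.1 z.2 :=
    measurable_from_prod_countable_left fun i => measurable_pi_apply i
  exact this.comp (hg.prodMk hi)

theorem measurable_erase_comp {S : E → Finset (Fin N)} (hS : Measurable S) {i : E → Fin N}
    (hi : Measurable i) : Measurable fun x => (S x).erase (i x) :=
  (measurable_of_countable fun z : Finset (Fin N) × Fin N => z.1.erase z.2).comp (hS.prodMk hi)

theorem measurable_orderPath (ρ : Equiv.Perm (Fin N)) (n : Fin N) (m : ℕ) :
    MeasurableList m (fun y => (orderPath ρ n y m).1) ∧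
      Measurable fun y => (orderPath ρ n y m).2 := by
  induction m with
  | zero => exact ⟨MeasurableList.const [], measurable_const⟩
  | succ m ih =>
    have hi := measurable_firstOut_comp ρ measurable_id
      (measurable_erase_comp ih.2 (measurable_const (a := n)))
    exact ⟨ih.1.cons (measurable_apply_comp measurable_id hi), measurable_erase_comp ih.2 hi⟩

theorem measurable_nextPrice {w : (Fin N → ℝ) → ℝ} (hw : Measurable w) (ρ : Equiv.Perm (Fin N))
    (n : Fin N) (m : ℕ) : Measurable (nextPrice w ρ n m) := by
  obtain ⟨h1, h2⟩ := measurable_orderPath ρ n m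
  have hi := measurable_firstOut_comp ρ measurable_id
    (measurable_erase_comp h2 (measurable_const (a := n)))
  exact hw.comp (h1.measurable_stack (measurable_apply_comp measurable_id hi))

theorem measurableList_pricePath {w : (Fin N → ℝ) → ℝ} (hw : Measurable w)
    (ρ : Equiv.Perm (Fin N)) (n : Fin N) (m : ℕ) :
    MeasurableList m fun y => pricePath w ρ n y m := by
  induction m with
  | zero => exact MeasurableList.const []
  | succ m ih => exact ih.cons (measurable_nextPrice hw ρ n m)

theorem orderPath_mem {I : Set ℝ} (ρ : Equiv.Perm (Fin N)) (n : Fin N) {y : Fin N → ℝ}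
    (hy : y ∈ signalSpace N I) (m : ℕ) : ∀ x ∈ (orderPath ρ n y m).1, x ∈ I := by
  induction m with
  | zero => simp [orderPath]
  | succ m ih =>
    intro x hx
    rcases List.mem_cons.1 hx with rfl | hx
    exacts [hy _, ih x hx]

theorem nextPrice_congr {I : Set ℝ} {w w' : (Fin N → ℝ) → ℝ} (h : ∀ x ∈ signalSpace N I, w x = w' x)
    (ρ : Equiv.Perm (Fin N)) (n : Fin N) {y : Fin N → ℝ} (hy : y ∈ signalSpace N I) (m : ℕ) :
    nextPrice w ρ n m y = nextPrice w' ρ n m y :=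
  h _ (stack_mem (hy _) (orderPath_mem ρ n hy m))

theorem pricePath_congr {I : Set ℝ} {w w' : (Fin N → ℝ) → ℝ} (h : ∀ x ∈ signalSpace N I, w x = w' x)
    (ρ : Equiv.Perm (Fin N)) (n : Fin N) {y : Fin N → ℝ} (hy : y ∈ signalSpace N I) (m : ℕ) :
    pricePath w ρ n y m = pricePath w' ρ n y m := by
  induction m with
  | zero => rfl
  | succ m ih => simp only [pricePath, ih, nextPrice_congr h ρ n hy]

theorem measurable_topOther (n : Fin N) : Measurable (topOther n) :=
  Measurable.iSup fun j => measurable_pi_apply (j : Fin N)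

theorem topOther_mem {I : Set ℝ} (hN : 2 ≤ N) (n : Fin N) {y : Fin N → ℝ}
    (hy : y ∈ signalSpace N I) : topOther n y ∈ I := by
  have : Nonempty {j : Fin N // j ≠ n} := by
    have : Nontrivial (Fin N) := Fin.nontrivial_iff_two_le.2 hN
    obtain ⟨j, hj⟩ := exists_ne n
    exact ⟨⟨j, hj⟩⟩
  obtain ⟨j, hj⟩ := exists_eq_ciSup_of_finite (f := fun j : {j : Fin N // j ≠ n} => y j)
  rw [topOther, ← hj]
  exact hy _

theorem measurable_finalPrice {w : (Fin N → ℝ) → ℝ} (hw : Measurable w) (n : Fin N) :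
    Measurable fun y => finalPrice w n y (topOther n y) := by
  refine hw.comp (measurable_pi_lambda _ fun i => ?_)
  simp only [Function.comp_apply, Function.update_apply]
  split_ifs
  exacts [measurable_topOther n, measurable_pi_apply _]

/-- The set of signals for which buyer `n` wins is measurable, if the others use the candidate
strategy and the node is consistent with the observations. -/
theorem measurableSet_win {I : Set ℝ} {w w' : (Fin N → ℝ) → ℝ}
    {V : Fin N → (Fin N → ℝ) → ℝ → ℝ} {q : List ℝ → ℝ} (R : IsPriceRule I w V)
    (hq : IsInference w I q) (hw' : Measurable w') (hww : ∀ x ∈ signalSpace N I, w x = w' x)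
    (ρ : Equiv.Perm (Fin N)) (n : Fin N) {τ : Strategy} (hτ : τ.IsMeasurable) :
    ∀ (k m : ℕ) {G : Set (Fin N → ℝ)} {h L : (Fin N → ℝ) → List ℝ} {c : (Fin N → ℝ) → EReal}
      {S : (Fin N → ℝ) → Finset (Fin N)}, MeasurableSet G → MeasurableList m h →
      MeasurableList m L → Measurable c → Measurable S →
      (∀ y ∈ G, IsConsistent w I q n y (S y) (h y) (c y) ∧ inferred q (h y) = L y ∧
        (S y).card = k + 1) →
      MeasurableSet {y | y ∈ G ∧ (play ρ (deviate w q n τ) y k (h y) (c y) (S y)).1 = n} := by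
  intro k
  induction k with
  | zero =>
    intro m G h L c S hG _ _ _ _ hcon
    convert hG using 1
    ext y
    refine ⟨fun hy => hy.1, fun hy => ⟨hy, ?_⟩⟩
    obtain ⟨hc, -, hS⟩ := hcon y hy
    exact Finset.card_le_one.1 hS.le _ (play_fst_mem _ y 0 _ _ _ hS) _ hc.active
  | succ k ih =>
    intro m G h L c S hG hh hL hc hS hcon
    set i : (Fin N → ℝ) → Fin N := fun y => firstOut ρ y ((S y).erase n) with hidef
    set p : (Fin N → ℝ) → ℝ := fun y => w' (stack N (y (i y)) (L y)) with hpdef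
    set e : (Fin N → ℝ) → ℝ := fun y => (max (c y) ((τ (y n) (h y) : ℝ) : EReal)).toReal with hedef
    have hi : Measurable i :=
      measurable_firstOut_comp ρ measurable_id (measurable_erase_comp hS measurable_const)
    have hp : Measurable p := hw'.comp (hL.measurable_stack (measurable_apply_comp measurable_id hi))
    have he : Measurable e := by
      have := hh.measurable_strategy hτ (measurable_pi_apply n)
      exact (hc.max this.coe_real_ereal).ereal_toReal
    -- On `G'` the lowest rival `i` leaves before `n`, at the price `p`, with ties settled by
    -- priority. Both `p` and the list `L` of inferred signals are carried as measurable functions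
    -- of `y`, because `q` itself may not be measurable.
    set G' : Set (Fin N → ℝ) := G ∩ {y | p y < e y ∨ (p y = e y ∧ ρ (i y) ≤ ρ n)} with hG'def
    have hρ : MeasurableSet {y | ρ (i y) ≤ ρ n} := hi (Set.toFinite {j | ρ j ≤ ρ n}).measurableSet
    have hG' : MeasurableSet G' :=
      hG.inter ((measurableSet_lt hp he).union
        ((measurableSet_eq_fun hp he).inter hρ))
    have hfacts : ∀ y ∈ G, i y ∈ S y ∧ i y ≠ n ∧ (∀ j ∈ S y, j ≠ n → y (i y) ≤ y j) ∧
        bid w q (y (i y)) (h y) = p y ∧ (firstOut ρ (exitPrice (deviate w q n τ) y (h y) (c y)) (S y) ≠ n ↔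
          y ∈ G') ∧ (firstOut ρ (exitPrice (deviate w q n τ) y (h y) (c y)) (S y) ≠ n →
            firstOut ρ (exitPrice (deviate w q n τ) y (h y) (c y)) (S y) = i y) := by
      intro y hy
      obtain ⟨hcy, hLy, hSy⟩ := hcon y hy
      have hne : ((S y).erase n).Nonempty := Finset.card_pos.1 (by
        rw [Finset.card_erase_of_mem hcy.active]; omega)
      have him := Finset.mem_erase.1 (firstOut_mem ρ y hne)
      have hbid : bid w q (y (i y)) (h y) = p y := by
        change w (stack N (y (i y)) (inferred q (h y))) = w' (stack N (y (i y)) (L y))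
        rw [hLy, hww]
        exact stack_mem (hcy.mem _) (hLy ▸ hq.inferred_mem _)
      have hfirst := hcy.firstOut_erase (ρ := ρ) R hq (σ := deviate w q n τ)
        (fun j hj => Function.update_of_ne hj _ _) (by omega)
      have hexi : exitPrice (deviate w q n τ) y (h y) (c y) (i y) = p y := by
        rw [hcy.exitPrice_eq him.2 him.1 (Function.update_of_ne him.1 _ _), hbid]
      have hexn : exitPrice (deviate w q n τ) y (h y) (c y) n = e y := by
        rw [exitPrice, deviate_self]
      have heq : firstOut ρ (exitPrice (deviate w q n τ) y (h y) (c y)) (S y) ≠ n →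
            firstOut ρ (exitPrice (deviate w q n τ) y (h y) (c y)) (S y) = i y := by
        intro hn
        obtain ⟨h1, h2⟩ := firstOut_spec ρ (exitPrice (deviate w q n τ) y (h y) (c y))
          ⟨n, hcy.active⟩
        rw [hidef]
        simp only
        rw [← hfirst]
        exact (firstOut_eq (Finset.mem_erase.2 ⟨hn, h1⟩)
          fun j hj => h2 j (Finset.mem_of_mem_erase hj)).symm
      refine ⟨him.2, him.1, fun j hj hjn => firstOut_le ρ y (Finset.mem_erase.2 ⟨hjn, hj⟩), hbid,
        ⟨fun hn => ⟨hy, ?_⟩, fun hyG => ?_⟩, heq⟩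
      · have h2 := (firstOut_spec ρ (exitPrice (deviate w q n τ) y (h y) (c y))
          ⟨n, hcy.active⟩).2 n hcy.active
        rwa [heq hn, hexi, hexn] at h2
      · have : firstOut ρ (exitPrice (deviate w q n τ) y (h y) (c y)) (S y) = i y := by
          refine firstOut_eq him.2 fun j hj => ?_
          rcases eq_or_ne j n with rfl | hjn
          · rw [hexi, hexn]
            exact hyG.2
          · have := (firstOut_spec ρ (exitPrice (deviate w q n τ) y (h y) (c y)) hne).2 j
              (Finset.mem_erase.2 ⟨hjn, hj⟩)
            rwa [hfirst] at this
        rw [this]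
        exact him.1
    have hIH := ih (m + 1) (G := G') (h := fun y => p y :: h y) (L := fun y => y (i y) :: L y)
      (c := fun y => (p y : EReal)) (S := fun y => (S y).erase (i y))
      hG' (hh.cons hp) (hL.cons (measurable_apply_comp measurable_id hi)) hp.coe_real_ereal
      (measurable_erase_comp hS hi) (fun y hy => by
        obtain ⟨hcy, hLy, hSy⟩ := hcon y hy.1
        obtain ⟨h1, h2, h3, h4, -⟩ := hfacts y hy.1
        have hstep := hcy.step R hq h1 h2 h3
        rw [h4] at hstep
        refine ⟨hstep, ?_, by rw [Finset.card_erase_of_mem h1, hSy]; rfl⟩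
        simp only [inferred, hLy]
        rw [← h4, inference_bid R hq (hcy.length_add_two_le h1 h2) (hcy.mem _)])
    convert hIH using 1
    ext y
    simp only [Set.mem_ofPred_eq]
    constructor
    · rintro ⟨hy, hwin⟩
      obtain ⟨hcy, hLy, hSy⟩ := hcon y hy
      obtain ⟨h1, h2, h3, h4, h5, h6⟩ := hfacts y hy
      have hn := ne_firstOut_of_play_eq hSy hwin
      refine ⟨h5.1 hn, ?_⟩
      rwa [play_succ _ k (h6 hn) ((hcy.exitPrice_eq h1 h2 (Function.update_of_ne h2 _ _)).trans h4)]
        at hwin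
    · rintro ⟨hy, hwin⟩
      obtain ⟨hcy, hLy, hSy⟩ := hcon y hy.1
      obtain ⟨h1, h2, h3, h4, h5, h6⟩ := hfacts y hy.1
      refine ⟨hy.1, ?_⟩
      rwa [play_succ _ k (h6 (h5.2 hy))
        ((hcy.exitPrice_eq h1 h2 (Function.update_of_ne h2 _ _)).trans h4)]

end Measurability

/-! ### Conditioning a conditional law on an event -/

section Conditioning

variable {Ω E F : Type*} [MeasurableSpace Ω] [MeasurableSpace E] [StandardBorelSpace E] [Nonempty E]
  [MeasurableSpace F] {P : Measure Ω} [IsProbabilityMeasure P] {W : Ω → E} {O : Ω → F}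

/-- Disintegration of the joint law of `O` and `W`. -/
theorem lintegral_condDistrib (hW : Measurable W) (hO : Measurable O) {g : F × E → ENNReal}
    (hg : Measurable g) :
    ∫⁻ ω, g (O ω, W ω) ∂P = ∫⁻ ω, ∫⁻ x, g (O ω, x) ∂(condDistrib W O P (O ω)) ∂P := by
  rw [← lintegral_map hg (hO.prodMk hW), ← compProd_map_condDistrib hW.aemeasurable,
    Measure.lintegral_compProd hg, lintegral_map _ hO]
  exact hg.lintegral_kernel_prod_right'

theorem ae_condDistrib (hW : Measurable W) (hO : Measurable O) {p : F × E → Prop}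
    (hp : MeasurableSet {z | p z}) (h : ∀ᵐ ω ∂P, p (O ω, W ω)) :
    ∀ᵐ ω ∂P, ∀ᵐ x ∂(condDistrib W O P (O ω)), p (O ω, x) := by
  have h1 : ∀ᵐ z ∂(P.map fun ω => (O ω, W ω)), p z := (ae_map_iff (hO.prodMk hW).aemeasurable hp).2 h
  rw [← compProd_map_condDistrib hW.aemeasurable] at h1
  exact ae_of_ae_map hO.aemeasurable (Measure.ae_ae_of_ae_compProd h1)

theorem ae_integrable_condDistrib (hW : Measurable W) (hO : Measurable O) {g : E → ℝ}
    (hg : Measurable g) (hinteg : Integrable (fun ω => g (W ω)) P) :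
    ∀ᵐ ω ∂P, Integrable g (condDistrib W O P (O ω)) := by
  have hm : Measurable fun z : F × E => g z.2 := hg.comp measurable_snd
  have h1 : Integrable (fun z : F × E => g z.2) (P.map fun ω => (O ω, W ω)) :=
    (integrable_map_measure hm.aestronglyMeasurable (hO.prodMk hW).aemeasurable).2 hinteg
  rw [← compProd_map_condDistrib hW.aemeasurable,
    Measure.integrable_compProd_iff hm.aestronglyMeasurable] at h1
  exact ae_of_ae_map hO.aemeasurable h1.1

/-- Points of `R` lying over an observation whose section is null form a null set of the joint law,
by disintegration. This makes conditioning on the section meaningful almost surely on the event. -/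
theorem ae_cond_condDistrib_ne_zero (hW : Measurable W) (hO : Measurable O) {R : Set (F × E)}
    (hR : MeasurableSet R) :
    ∀ᵐ ω ∂P[|{ω | (O ω, W ω) ∈ R}], condDistrib W O P (O ω) {x | (O ω, x) ∈ R} ≠ 0 := by
  have hA : MeasurableSet {ω | (O ω, W ω) ∈ R} := (hO.prodMk hW) hR
  have hm : Measurable fun o => condDistrib W O P o {x | (o, x) ∈ R} :=
    Kernel.measurable_kernel_prodMk_left hR
  refine Measure.ae_smul_measure ((ae_restrict_iff' hA).2 ?_) _
  set Q : Set (F × E) := R ∩ {z | condDistrib W O P z.1 {x | (z.1, x) ∈ R} = 0} with hQdef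
  have hQ : MeasurableSet Q := hR.inter (measurableSet_eq_fun (hm.comp measurable_fst) measurable_const)
  have h0 : P ((fun ω => (O ω, W ω)) ⁻¹' Q) = 0 := by
    rw [← one_mul (P _), ← lintegral_indicator_const ((hO.prodMk hW) hQ)]
    change ∫⁻ ω, Q.indicator (fun _ => 1) (O ω, W ω) ∂P = 0
    rw [lintegral_condDistrib hW hO (measurable_const.indicator hQ)]
    refine lintegral_eq_zero_of_ae_eq_zero (Filter.Eventually.of_forall fun ω => ?_)
    change ∫⁻ x, ((fun x => (O ω, x)) ⁻¹' Q).indicator (fun _ => 1) x ∂_ = 0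
    rw [lintegral_indicator_const (measurable_prodMk_left hQ), one_mul]
    by_cases hω : condDistrib W O P (O ω) {x | (O ω, x) ∈ R} = 0
    · exact measure_mono_null (fun x hx => hx.1) hω
    · exact measure_mono_null (fun x hx => absurd hx.2 hω) measure_empty
  have h1 : ∀ᵐ ω ∂P, (O ω, W ω) ∉ Q := measure_eq_zero_iff_ae_notMem.1 h0
  filter_upwards [h1] with ω hω hωA h
  exact hω ⟨hωA, h⟩

/-- Conditioning in two stages: weighting the ratio `G` by the probability of the section of `R`
gives the probability of its intersection with `D`. Integrating this over observations in `t` turns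
both sides of the defining identity of conditional expectation into the same joint probability. -/
theorem cond_condDistrib_ae_eq_condExp (hW : Measurable W) (hO : Measurable O) {R : Set (F × E)}
    (hR : MeasurableSet R) {D : Set E} (hD : MeasurableSet D) :
    (fun ω => ((condDistrib W O P (O ω))[|{x | (O ω, x) ∈ R}]).real D)
      =ᵐ[P[|{ω | (O ω, W ω) ∈ R}]]
    (P[|{ω | (O ω, W ω) ∈ R}])[(W ⁻¹' D).indicator (fun _ => (1 : ℝ)) |
      MeasurableSpace.comap O inferInstance] := by
  set A := {ω | (O ω, W ω) ∈ R} with hAdef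
  have hA : MeasurableSet A := (hO.prodMk hW) hR
  by_cases hPA : P A = 0
  · rw [cond_eq_zero_of_meas_eq_zero hPA]
    rw [Filter.EventuallyEq, ae_zero]
    exact Filter.eventually_bot
  have := cond_isProbabilityMeasure hPA
  have hRo : ∀ o : F, MeasurableSet {x | (o, x) ∈ R} := fun o => measurable_prodMk_left hR
  set G : F → ENNReal := fun o => (condDistrib W O P o)[|{x | (o, x) ∈ R}] D with hGdef
  have hGeq : ∀ o, G o = (condDistrib W O P o {x | (o, x) ∈ R})⁻¹ *
      condDistrib W O P o {x | (o, x) ∈ R ∧ x ∈ D} := fun o => cond_apply (hRo o) _ _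
  have hRD : MeasurableSet {z : F × E | z ∈ R ∧ z.2 ∈ D} := hR.inter (measurable_snd hD)
  have hRDo : ∀ o : F, MeasurableSet {x | (o, x) ∈ R ∧ x ∈ D} := fun o => measurable_prodMk_left hRD
  have hG : Measurable G := by
    simp only [funext hGeq]
    exact (Kernel.measurable_kernel_prodMk_left hR).inv.mul (Kernel.measurable_kernel_prodMk_left hRD)
  have hG1 : ∀ o, G o ≤ 1 := fun o => (measure_mono (Set.subset_univ D)).trans (by
    rw [cond_apply (hRo o), Set.inter_univ]
    exact ENNReal.inv_mul_le_one _)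
  -- Over a null section the conditioned measure is zero, and the identity still holds because both
  -- sides vanish.
  have hGK : ∀ o, condDistrib W O P o {x | (o, x) ∈ R} * G o
      = condDistrib W O P o {x | (o, x) ∈ R ∧ x ∈ D} := fun o => by
    rw [hGeq, ← mul_assoc]
    by_cases h0 : condDistrib W O P o {x | (o, x) ∈ R} = 0
    · rw [h0, zero_mul, zero_mul]
      exact (measure_mono_null (fun x hx => hx.1) h0).symm
    · rw [ENNReal.mul_inv_cancel h0 (measure_ne_top _ _), one_mul]
  have hGint : Integrable (fun ω => (G (O ω)).toReal) P[|A] :=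
    Integrable.of_bound (hG.comp hO).ennreal_toReal.aestronglyMeasurable 1
      (Filter.Eventually.of_forall fun ω => by
        rw [Real.norm_of_nonneg ENNReal.toReal_nonneg]
        exact ENNReal.toReal_le_of_le_ofReal zero_le_one (by simpa using hG1 _))
  refine ae_eq_condExp_of_forall_setIntegral_eq hO.comap_le
    ((integrable_const (1 : ℝ)).indicator (hW hD)) (fun s _ _ => hGint.integrableOn) ?_ ?_
  · rintro _ ⟨t, ht, rfl⟩ _
    rw [setIntegral_indicator (hW hD), setIntegral_one_eq_measureReal]
    change ∫ ω in O ⁻¹' t, (G (O ω)).toReal ∂P[|A] = _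
    rw [integral_toReal (f := fun ω => G (O ω)) (hG.comp hO).aemeasurable
      (Filter.Eventually.of_forall fun ω => (hG1 _).trans_lt ENNReal.one_lt_top), measureReal_def]
    congr 1
    rw [cond_apply hA, ProbabilityTheory.cond, Measure.restrict_smul, lintegral_smul_measure, smul_eq_mul]
    congr 1
    rw [Measure.restrict_restrict (hO ht), ← lintegral_indicator ((hO ht).inter hA)]
    have e1 : ∀ ω, (O ⁻¹' t ∩ A).indicator (fun ω => G (O ω)) ω
        = ({z : F × E | z.1 ∈ t} ∩ R).indicator (fun z => G z.1) (O ω, W ω) := fun ω => rfl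
    have htR : MeasurableSet ({z : F × E | z.1 ∈ t} ∩ R) := (measurable_fst ht).inter hR
    simp only [e1]
    rw [lintegral_condDistrib hW hO (g := ({z : F × E | z.1 ∈ t} ∩ R).indicator fun z => G z.1)
      ((hG.comp measurable_fst).indicator htR)]
    have e2 : ∀ ω, ∫⁻ x, ({z : F × E | z.1 ∈ t} ∩ R).indicator (fun z => G z.1) (O ω, x)
          ∂(condDistrib W O P (O ω))
        = ∫⁻ x, ({z : F × E | z.1 ∈ t} ∩ {z : F × E | z ∈ R ∧ z.2 ∈ D}).indicator 1 (O ω, x)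
          ∂(condDistrib W O P (O ω)) := fun ω => by
      by_cases hωt : O ω ∈ t
      · have e3 : ∀ x, ({z : F × E | z.1 ∈ t} ∩ R).indicator (fun z => G z.1) (O ω, x)
            = {x | (O ω, x) ∈ R}.indicator (fun _ => G (O ω)) x := fun x => by
          by_cases hx : (O ω, x) ∈ R <;> simp [Set.indicator, hx, hωt]
        have e4 : ∀ x, ({z : F × E | z.1 ∈ t} ∩ {z : F × E | z ∈ R ∧ z.2 ∈ D}).indicator
              (1 : F × E → ENNReal) (O ω, x)
            = {x | (O ω, x) ∈ R ∧ x ∈ D}.indicator (fun _ => 1) x := fun x => by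
          by_cases hx : (O ω, x) ∈ R ∧ x ∈ D <;> simp [Set.indicator, hx, hωt]
        simp only [e3, e4]
        rw [lintegral_indicator_const (hRo _), lintegral_indicator_const (hRDo _), one_mul, mul_comm,
          hGK]
      · have e3 : ∀ x, ({z : F × E | z.1 ∈ t} ∩ R).indicator (fun z => G z.1) (O ω, x) = 0 :=
          fun x => Set.indicator_of_notMem (fun h => hωt h.1) _
        have e4 : ∀ x, ({z : F × E | z.1 ∈ t} ∩ {z : F × E | z ∈ R ∧ z.2 ∈ D}).indicator
              (1 : F × E → ENNReal) (O ω, x) = 0 :=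
          fun x => Set.indicator_of_notMem (fun h => hωt h.1) _
        simp only [e3, e4]
    simp only [e2]
    rw [← lintegral_condDistrib hW hO
      (g := ({z : F × E | z.1 ∈ t} ∩ {z : F × E | z ∈ R ∧ z.2 ∈ D}).indicator 1)
      (measurable_one.indicator ((measurable_fst ht).inter hRD))]
    have e5 : ∀ ω, ({z : F × E | z.1 ∈ t} ∩ {z : F × E | z ∈ R ∧ z.2 ∈ D}).indicator
        (1 : F × E → ENNReal) (O ω, W ω) = (A ∩ (O ⁻¹' t ∩ W ⁻¹' D)).indicator (fun _ => 1) ω :=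
      fun ω => by
        by_cases h1 : O ω ∈ t <;> by_cases h2 : (O ω, W ω) ∈ R <;> by_cases h3 : W ω ∈ D <;>
          simp [Set.indicator, h1, h2, h3, hAdef]
    simp only [e5]
    rw [lintegral_indicator_const (hA.inter ((hO ht).inter (hW hD))), one_mul]
  · exact ((hG.comp (comap_measurable O)).ennreal_toReal).stronglyMeasurable.aestronglyMeasurable

end Conditioning

/-! ### Integrability of the utility from winning -/

section Utility

variable {Ω : Type*} [MeasurableSpace Ω] {P : Measure Ω} [IsProbabilityMeasure P] {N : ℕ} [NeZero N]
  {X Y : Fin N → Ω → ℝ} {I : Set ℝ} {f : (Fin N → ℝ) → ℝ}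
  {κ : Fin N → Kernel (Fin N → ℝ) ℝ} {u : ℝ → ℝ} {C : Contract} {α : ℝ}

theorem measurableSet_signalSpace (hI : I.OrdConnected) : MeasurableSet (signalSpace N I) := by
  have : signalSpace N I = Set.univ.pi fun _ => I := by
    ext y
    simp [signalSpace]
  rw [this]
  exact MeasurableSet.univ_pi fun _ => hI.measurableSet

theorem Model.measurable_utility_profit (hM : Model P X Y I f κ u) :
    Measurable fun z : ℝ × ℝ => u (profit C α z.1 z.2) :=
  hM.increasing.monotone.measurable.comp (measurable_profit C α)

/-- The indifference price agrees on the signal vectors with a measurable function. -/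
theorem exists_measurable_indiffPrice (hM : Model P X Y I f κ u) (hα0 : 0 ≤ α) (hα1 : α < 1)
    (hfin : FiniteUtilities P X Y I κ u C α) :
    ∃ w : (Fin N → ℝ) → ℝ, Measurable w ∧ ∀ x ∈ signalSpace N I, indiffPrice κ u C α x = w x := by
  classical
  have hS : MeasurableSet (signalSpace N I) := measurableSet_signalSpace hM.interval
  -- Off the signal space the choice operator is uncontrolled, hence the indicator. On it, being at
  -- most `b` means nonpositive utility at `b`, a measurable condition.
  refine ⟨(signalSpace N I).indicator (indiffPrice κ u C α), measurable_of_Iic fun b => ?_,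
    fun x hx => (Set.indicator_of_mem hx _).symm⟩
  have hV : Measurable fun x => winUtility κ u C α 0 x b := by
    have h1 : StronglyMeasurable fun x => u (profit C α x b) :=
      (hM.measurable_utility_profit.comp measurable_prodMk_right).stronglyMeasurable
    exact (h1.integral_kernel (κ := κ 0)).measurable
  have e : (signalSpace N I).indicator (indiffPrice κ u C α) ⁻¹' Set.Iic b
      = (signalSpace N I ∩ {x | winUtility κ u C α 0 x b ≤ 0}) ∪
        ((signalSpace N I)ᶜ ∩ {_x | 0 ≤ b}) := by
    ext x
    by_cases hx : x ∈ signalSpace N I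
    · simp [hx, indiffPrice_le_iff hM hα0 hα1 hfin hx]
    · simp [hx]
  rw [e]
  exact (hS.inter (measurableSet_le hV measurable_const)).union
    (hS.compl.inter (MeasurableSet.const _))

theorem measurable_winUtility (hM : Model P X Y I f κ u) (n : Fin N) {F : (Fin N → ℝ) → ℝ}
    (hF : Measurable F) : Measurable fun y => winUtility κ u C α n y (F y) := by
  have := hM.markov n
  have h1 : StronglyMeasurable fun z : (Fin N → ℝ) × ℝ => u (profit C α z.2 (F z.1)) :=
    (hM.measurable_utility_profit.comp
      (measurable_snd.prodMk (hF.comp measurable_fst))).stronglyMeasurable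
  exact (h1.integral_kernel_prod_right' (κ := κ n)).measurable

theorem topOther_comp_swap (n : Fin N) (y : Fin N → ℝ) :
    topOther 0 (y ∘ Equiv.swap 0 n) = topOther n y := by
  have h : ∀ j : Fin N, j ≠ 0 ↔ Equiv.swap 0 n j ≠ n := fun j => by
    rw [Ne, Ne, Equiv.swap_apply_eq_iff, Equiv.swap_apply_right]
  exact Equiv.iSup_congr ((Equiv.swap 0 n).subtypeEquiv h) fun j => rfl

/-- Puts the final price of buyer `n` into the form that `FiniteUtilities.winning` uses for buyer
`0`. -/
theorem finalPrice_comp_swap (w : (Fin N → ℝ) → ℝ) (n : Fin N) (y : Fin N → ℝ) :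
    finalPrice w n y (topOther n y)
      = w (Function.update (y ∘ Equiv.swap 0 n) 0 (topOther 0 (y ∘ Equiv.swap 0 n))) := by
  rw [topOther_comp_swap, finalPrice]
  congr 1
  funext j
  by_cases hj : j = 0
  · subst hj
    simp
  · have : Equiv.swap 0 n j ≠ n := by
      rw [Ne, Equiv.swap_apply_eq_iff, Equiv.swap_apply_right]
      exact hj
    simp [hj, this]

/-- The expected utility from winning against the candidate strategy is integrable. -/
theorem integrable_winUtility_finalPrice (hN : 2 ≤ N) (hM : Model P X Y I f κ u)
    (hfin : FiniteUtilities P X Y I κ u C α) {w : (Fin N → ℝ) → ℝ} (hw : Measurable w)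
    (hww : ∀ x ∈ signalSpace N I, indiffPrice κ u C α x = w x) (n : Fin N) :
    Integrable (fun ω => winUtility κ u C α n (fun i => Y i ω)
      (finalPrice w n (fun i => Y i ω) (topOther n fun i => Y i ω))) P := by
  have hY : Measurable fun ω i => Y i ω := measurable_pi_lambda _ hM.measurable_Y
  have hYmem : ∀ ω, (fun i => Y i ω) ∈ signalSpace N I := fun ω i => hM.signal_mem i ω
  have hup : Measurable fun y : Fin N → ℝ => Function.update y 0 (topOther 0 y) := by
    refine measurable_pi_lambda _ fun i => ?_
    simp only [Function.update_apply]
    split_ifs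
    exacts [measurable_topOther 0, measurable_pi_apply _]
  set Φ : ℝ × (Fin N → ℝ) → ℝ :=
    fun z => u (profit C α z.1 (w (Function.update z.2 0 (topOther 0 z.2)))) with hΦdef
  have hΦ : Measurable Φ := hM.measurable_utility_profit.comp
    (measurable_fst.prodMk (hw.comp (hup.comp measurable_snd)))
  have h0 : Integrable (fun ω => Φ (X 0 ω, fun i => Y i ω)) P := by
    refine hfin.winning.congr (Filter.Eventually.of_forall fun ω => ?_)
    simp only [hΦdef]
    rw [← hww _ (update_mem_signalSpace (hYmem ω) (topOther_mem hN 0 (hYmem ω)))]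
    rfl
  have h1 : Integrable Φ (P.map fun ω => (X 0 ω, fun i => Y i ω)) :=
    (integrable_map_measure hΦ.aestronglyMeasurable
      ((hM.measurable_X 0).prodMk hY).aemeasurable).2 h0
  -- Symmetry of the joint law carries integrability from buyer `0` to buyer `n`.
  rw [← hM.law_symm (Equiv.swap 0 n) 0, Equiv.swap_apply_left,
    integrable_map_measure hΦ.aestronglyMeasurable ((hM.measurable_X n).prodMk
      (measurable_pi_lambda _ fun i => hM.measurable_Y _)).aemeasurable] at h1
  set F : (Fin N → ℝ) → ℝ := fun y => finalPrice w n y (topOther n y) with hFdef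
  have hF : Measurable F := measurable_finalPrice hw n
  set Ψ : (Fin N → ℝ) × ℝ → ℝ := fun z => u (profit C α z.2 (F z.1)) with hΨdef
  have hΨ : Measurable Ψ := hM.measurable_utility_profit.comp
    (measurable_snd.prodMk (hF.comp measurable_fst))
  have h2 : Integrable (fun ω => Ψ ((fun i => Y i ω), X n ω)) P := by
    refine h1.congr (Filter.Eventually.of_forall fun ω => ?_)
    simp only [hΨdef, hFdef, finalPrice_comp_swap]
    rfl
  have h3 : Integrable Ψ (P.map fun ω => ((fun i => Y i ω), X n ω)) :=
    (integrable_map_measure hΨ.aestronglyMeasurable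
      (hY.prodMk (hM.measurable_X n)).aemeasurable).2 h2
  rw [hM.cond_law n] at h3
  have := hM.markov n
  -- Integrating out the value given the signals preserves integrability, since the norm of an
  -- integral is at most the integral of the norm.
  have h4 : Integrable (fun y => winUtility κ u C α n y (F y)) (P.map fun ω i => Y i ω) :=
    ((Measure.integrable_compProd_iff hΨ.aestronglyMeasurable).1 h3).2.mono'
      (measurable_winUtility hM n hF).aestronglyMeasurable
      (Filter.Eventually.of_forall fun y => norm_integral_le_integral_norm _)
  exact (integrable_map_measure (measurable_winUtility hM n hF).aestronglyMeasurable
    hY.aemeasurable).1 h4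

end Utility

section Equilibrium

variable {Ω : Type*} [MeasurableSpace Ω] {P : Measure Ω} [IsProbabilityMeasure P] {N : ℕ} [NeZero N]
  {Y : Fin N → Ω → ℝ} {I : Set ℝ} {w w' : (Fin N → ℝ) → ℝ} {V : Fin N → (Fin N → ℝ) → ℝ → ℝ}
  {q : List ℝ → ℝ} {ρ : Equiv.Perm (Fin N)} {n : Fin N} {m : ℕ} {a : ℝ} {h : List ℝ} {c : EReal}

/-! ### Nodes reached when the others use the candidate strategy -/

/-- Own signal and first `m` drop-out prices of buyer `n`, if the others leave in the order of their
signals. -/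
noncomputable def orderObserved (w : (Fin N → ℝ) → ℝ) (ρ : Equiv.Perm (Fin N)) (n : Fin N) (m : ℕ)
    (y : Fin N → ℝ) : ℝ × (Fin m → ℝ) :=
  (y n, fun j => (pricePath w ρ n y m).getD j 0)

/-- The node after `m` drop-outs, if the others leave in the order of their signals. -/
noncomputable def orderNode (ρ : Equiv.Perm (Fin N)) (n : Fin N) (m : ℕ) (y : Fin N → ℝ) : Node N :=
  (y, (orderPath ρ n y m).2)

/-- The expected utility of buyer `n` if he wins against the candidate strategy. -/
noncomputable def stayUtility (V : Fin N → (Fin N → ℝ) → ℝ → ℝ) (w : (Fin N → ℝ) → ℝ) (n : Fin N)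
    (y : Fin N → ℝ) : ℝ :=
  V n y (finalPrice w n y (topOther n y))

/-- What buyer `n` observes up to the `m`-th drop-out, as a function of the history. -/
def observation (m : ℕ) (a : ℝ) (h : List ℝ) : ℝ × (Fin m → ℝ) := (a, fun j => h.getD j 0)

/-- The signal vectors that lead to the observations `a`, `h` and no further drop-out up to the
clock price `c`. -/
def reachSet (I : Set ℝ) (w : (Fin N → ℝ) → ℝ) (ρ : Equiv.Perm (Fin N)) (n : Fin N) (m : ℕ) (a : ℝ)
    (h : List ℝ) (c : EReal) : Set (Fin N → ℝ) :=
  {y | (y ∈ signalSpace N I ∧ orderObserved w ρ n m y = observation m a h) ∧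
    c < (nextPrice w ρ n m y : ℝ)}

theorem measurable_orderObserved (hw : Measurable w) (ρ : Equiv.Perm (Fin N)) (n : Fin N) (m : ℕ) :
    Measurable (orderObserved w ρ n m) :=
  (measurable_pi_apply n).prodMk
    (measurable_pi_lambda _ fun j => (measurableList_pricePath hw ρ n m).measurable_getD j)

/-- A node contains the signal vector, so the map is injective. Being an embedding, it lets
integrability under the image law be tested after composition, without measurability of `nodePayoff`
on all nodes. -/
theorem measurableEmbedding_orderNode (ρ : Equiv.Perm (Fin N)) (n : Fin N) (m : ℕ) :
    MeasurableEmbedding (orderNode ρ n m) := by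
  have hm : Measurable (orderNode ρ n m) := measurable_id.prodMk (measurable_orderPath ρ n m).2
  exact hm.measurableEmbedding fun x y hxy => congrArg Prod.fst hxy

theorem measurableSet_reachSet (hI : MeasurableSet (signalSpace N I)) (hw : Measurable w)
    (ρ : Equiv.Perm (Fin N)) (n : Fin N) (m : ℕ) (a : ℝ) (h : List ℝ) (c : EReal) :
    MeasurableSet (reachSet I w ρ n m a h c) :=
  (hI.inter (measurableSet_eq_fun (measurable_orderObserved hw ρ n m) measurable_const)).inter
    (measurableSet_lt measurable_const (measurable_nextPrice hw ρ n m).coe_real_ereal)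

/-- What holds at the nodes of an information set that is reached when the others use the candidate
strategy. -/
structure IsReached (w : (Fin N → ℝ) → ℝ) (I : Set ℝ) (V : Fin N → (Fin N → ℝ) → ℝ → ℝ)
    (q : List ℝ → ℝ) (ρ : Equiv.Perm (Fin N)) (n : Fin N) (a : ℝ) (h : List ℝ) (c : EReal)
    (d : Node N) : Prop where
  signal : d.1 n = a
  consistent : IsConsistent w I q n d.1 d.2 h c
  payoff_deviate : ∀ τ : Strategy, nodePayoff V ρ (deviate w q n τ) n h c d
    = if (play ρ (deviate w q n τ) d.1 (d.2.card - 1) h c d.2).1 = n then stayUtility V w n d.1 else 0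
  payoff_bid : nodePayoff V ρ (deviate w q n (bid w q)) n h c d = max (stayUtility V w n d.1) 0
  payoff_le : ∀ τ : Strategy, nodePayoff V ρ (deviate w q n τ) n h c d
    ≤ nodePayoff V ρ (deviate w q n (bid w q)) n h c d

theorem isReached_orderNode (R : IsPriceRule I w V) (hq : IsInference w I q)
    (hww : ∀ x ∈ signalSpace N I, w x = w' x) (hl : h.length = m) (hm : m + 2 ≤ N)
    {y : Fin N → ℝ} (hy : y ∈ reachSet I w' ρ n m a h c) :
    IsReached w I V q ρ n a h c (orderNode ρ n m y) := by
  obtain ⟨⟨hyI, hobs⟩, hlt⟩ := hy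
  rw [← nextPrice_congr hww ρ n hyI] at hlt
  have hp := isOnPath R hq ρ n hyI m (by omega)
  have hh : pricePath w ρ n y m = h := by
    rw [pricePath_congr hww ρ n hyI, ← ofFn_getD (length_pricePath w' ρ n y m), ← ofFn_getD hl]
    exact congrArg List.ofFn (congrArg Prod.snd hobs)
  have hc := hp.isConsistent_of_lt R hq hlt
  have hbid : ∀ j ∈ (orderPath ρ n y m).2, j ≠ n → c < (bid w q (y j) (pricePath w ρ n y m) : ℝ) :=
    fun j hj hjn => hp.lt_bid R hq hlt hj hjn
  rw [hh] at hc hbid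
  obtain ⟨i, hi, hin, hmax, htop⟩ := hp.exists_topOther hm
  have hstay : V n y (finalPrice w n y (y i)) = stayUtility V w n y := by rw [htop]; rfl
  refine ⟨congrArg Prod.fst hobs, hc, fun τ => ?_, ?_, fun τ => ?_⟩
  · have := hc.nodePayoff_deviate (ρ := ρ) R hq hi hin hmax τ
    rwa [hstay] at this
  · have := hc.nodePayoff_bid (ρ := ρ) R hq hi hin hmax (Or.inr hbid)
    rwa [hstay] at this
  · refine hc.nodePayoff_le R hq ?_ (Or.inr hbid) τ
    exact Finset.one_lt_card.2 ⟨i, hi, n, hc.active, hin⟩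

theorem stayUtility_congr (hN : 2 ≤ N) (hww : ∀ x ∈ signalSpace N I, w x = w' x) (n : Fin N)
    {y : Fin N → ℝ} (hy : y ∈ signalSpace N I) : stayUtility V w n y = stayUtility V w' n y := by
  rw [stayUtility, stayUtility, finalPrice, finalPrice, hww]
  exact comp_mem_signalSpace (update_mem_signalSpace hy (topOther_mem hN n hy)) _

/-- Payoffs are integrable under a belief concentrated on such nodes, if the expected utility from
winning is. -/
theorem integrable_nodePayoff (R : IsPriceRule I w V) (hq : IsInference w I q) (hw' : Measurable w')
    (hww : ∀ x ∈ signalSpace N I, w x = w' x) (hI : MeasurableSet (signalSpace N I))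
    (hl : h.length = m) (hm : m + 2 ≤ N) {ν : Measure (Fin N → ℝ)}
    (hν : ∀ᵐ y ∂ν, y ∈ reachSet I w' ρ n m a h c) (hinteg : Integrable (stayUtility V w' n) ν) :
    Integrable (nodePayoff V ρ (deviate w q n (bid w q)) n h c) (ν.map (orderNode ρ n m)) ∧
    ∀ τ : Strategy, τ.IsMeasurable →
      Integrable (nodePayoff V ρ (deviate w q n τ) n h c) (ν.map (orderNode ρ n m)) := by
  have hreach : ∀ y ∈ reachSet I w' ρ n m a h c, IsReached w I V q ρ n a h c (orderNode ρ n m y) :=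
    fun y hy => isReached_orderNode R hq hww hl hm hy
  have hstay : ∀ y ∈ reachSet I w' ρ n m a h c, stayUtility V w n y = stayUtility V w' n y :=
    fun y hy => stayUtility_congr (by omega) hww n hy.1.1
  refine ⟨?_, fun τ hτ => ?_⟩
  · rw [(measurableEmbedding_orderNode ρ n m).integrable_map_iff]
    -- Under `bid` the payoff is the positive part of the utility from winning; under a deviation,
    -- below, it is that utility restricted to the measurable set of wins.
    refine (hinteg.sup (integrable_zero _ ℝ _)).congr ?_
    filter_upwards [hν] with y hy
    rw [Function.comp_apply, (hreach y hy).payoff_bid]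
    change max (stayUtility V w' n y) 0 = max (stayUtility V w n y) 0
    rw [hstay y hy]
  · rw [(measurableEmbedding_orderNode ρ n m).integrable_map_iff]
    have hcard : ∀ y ∈ reachSet I w' ρ n m a h c, (orderPath ρ n y m).2.card = N - m - 1 + 1 :=
      fun y hy => by
        have := (hreach y hy).consistent.card
        change (orderPath ρ n y m).2.card + h.length = N at this
        omega
    have hlinf : (inferred q h).length = h.length := length_inferred q h
    have hwin := measurableSet_win R hq hw' hww ρ n hτ (N - m - 1) h.length
      (h := fun _ => h) (L := fun _ => inferred q h) (c := fun _ => c)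
      (S := fun y => (orderPath ρ n y m).2)
      (measurableSet_reachSet hI hw' ρ n m a h c) (MeasurableList.const h)
      (hlinf ▸ MeasurableList.const (inferred q h)) measurable_const (measurable_orderPath ρ n m).2
      fun y hy => ⟨(hreach y hy).consistent, rfl, hcard y hy⟩
    refine (hinteg.indicator hwin).congr ?_
    filter_upwards [hν] with y hy
    rw [Function.comp_apply, (hreach y hy).payoff_deviate]
    have e : (orderNode ρ n m y).2.card - 1 = N - m - 1 := by
      have := hcard y hy
      change (orderPath ρ n y m).2.card - 1 = _
      omega
    rw [e]
    by_cases hwy : (play ρ (deviate w q n τ) y (N - m - 1) h c (orderPath ρ n y m).2).1 = n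
    · have hmem : y ∈ {y | y ∈ reachSet I w' ρ n m a h c ∧
          (play ρ (deviate w q n τ) y (N - m - 1) h c (orderPath ρ n y m).2).1 = n} := ⟨hy, hwy⟩
      rw [Set.indicator_of_mem hmem, ← hstay y hy]
      exact (if_pos hwy).symm
    · rw [Set.indicator_of_notMem (fun hmem => hwy hmem.2)]
      exact (if_neg hwy).symm

/-! ### Beliefs -/

/-- The conditional law of the signals given what buyer `n` has observed after `m` drop-outs. -/
noncomputable def signalLaw (P : Measure Ω) [IsProbabilityMeasure P] (Y : Fin N → Ω → ℝ)
    (w : (Fin N → ℝ) → ℝ) (ρ : Equiv.Perm (Fin N)) (n : Fin N) (m : ℕ) :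
    Kernel (ℝ × (Fin m → ℝ)) (Fin N → ℝ) :=
  condDistrib (fun ω i => Y i ω) (fun ω => orderObserved w ρ n m fun i => Y i ω) P

/-- The information set is reached with positive probability density, and the conditional law of
the signals is well behaved there. -/
def IsRegular (P : Measure Ω) [IsProbabilityMeasure P] (Y : Fin N → Ω → ℝ) (I : Set ℝ)
    (V : Fin N → (Fin N → ℝ) → ℝ → ℝ) (w : (Fin N → ℝ) → ℝ) (ρ : Equiv.Perm (Fin N)) (n : Fin N)
    (m : ℕ) (a : ℝ) (h : List ℝ) (c : EReal) : Prop :=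
  (∀ᵐ y ∂(signalLaw P Y w ρ n m (observation m a h)),
    y ∈ signalSpace N I ∧ orderObserved w ρ n m y = observation m a h) ∧
  Integrable (stayUtility V w n) (signalLaw P Y w ρ n m (observation m a h)) ∧
  signalLaw P Y w ρ n m (observation m a h) {y | c < (nextPrice w ρ n m y : ℝ)} ≠ 0

/-- The conditional law of the signals given the observations and the clock price. -/
noncomputable def clockLaw (P : Measure Ω) [IsProbabilityMeasure P] (Y : Fin N → Ω → ℝ)
    (w : (Fin N → ℝ) → ℝ) (ρ : Equiv.Perm (Fin N)) (n : Fin N) (m : ℕ) (a : ℝ) (h : List ℝ)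
    (c : EReal) : Measure (Fin N → ℝ) :=
  (signalLaw P Y w ρ n m (observation m a h))[|{y | c < (nextPrice w ρ n m y : ℝ)}]

open Classical in
/-- The belief given by Bayes' rule at regular information sets, and concentrated at the given nodes
`d₀` at the others. -/
noncomputable def belief (P : Measure Ω) [IsProbabilityMeasure P] (Y : Fin N → Ω → ℝ) (I : Set ℝ)
    (V : Fin N → (Fin N → ℝ) → ℝ → ℝ) (w : (Fin N → ℝ) → ℝ) (ρ : Equiv.Perm (Fin N))
    (d₀ : Fin N → ℝ → List ℝ → EReal → Node N) : Beliefs N := fun n a h c =>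
  if IsRegular P Y I V w ρ n h.length a h c then
    (clockLaw P Y w ρ n h.length a h c).map (orderNode ρ n h.length)
  else Measure.dirac (d₀ n a h c)

theorem belief_of_isRegular {d₀ : Fin N → ℝ → List ℝ → EReal → Node N} (hl : h.length = m)
    (hr : IsRegular P Y I V w ρ n m a h c) :
    belief P Y I V w ρ d₀ n a h c = (clockLaw P Y w ρ n m a h c).map (orderNode ρ n m) := by
  subst hl
  exact if_pos hr

instance (m : ℕ) : IsMarkovKernel (signalLaw P Y w ρ n m) := by
  unfold signalLaw
  infer_instance

theorem IsRegular.isProbabilityMeasure (hr : IsRegular P Y I V w ρ n m a h c) :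
    IsProbabilityMeasure (clockLaw P Y w ρ n m a h c) :=
  cond_isProbabilityMeasure hr.2.2

theorem IsRegular.ae_mem_reachSet (hw : Measurable w) (hr : IsRegular P Y I V w ρ n m a h c) :
    ∀ᵐ y ∂(clockLaw P Y w ρ n m a h c), y ∈ reachSet I w ρ n m a h c := by
  have hs : MeasurableSet {y | c < (nextPrice w ρ n m y : ℝ)} :=
    measurableSet_lt measurable_const (measurable_nextPrice hw ρ n m).coe_real_ereal
  refine Measure.ae_smul_measure ((ae_restrict_iff' hs).2 ?_) _
  filter_upwards [hr.1] with y hy hlt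
  exact ⟨hy, hlt⟩

theorem IsRegular.integrable_stayUtility (hr : IsRegular P Y I V w ρ n m a h c) :
    Integrable (stayUtility V w n) (clockLaw P Y w ρ n m a h c) :=
  (hr.2.1.restrict).smul_measure (ENNReal.inv_ne_top.2 hr.2.2)

theorem measurable_clock_ofFn (m : ℕ) :
    Measurable fun o : ℝ × (Fin m → ℝ) => clock (List.ofFn o.2) := by
  cases m with
  | zero => simp [clock]
  | succ m =>
    simp only [List.ofFn_succ, clock]
    exact ((measurable_pi_apply 0).comp measurable_snd).coe_real_ereal

/-- Bayes' rule for the belief. -/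
theorem belief_ae_eq_condExp (hY : Measurable fun ω i => Y i ω)
    (hYI : ∀ ω, (fun i => Y i ω) ∈ signalSpace N I) (R : IsPriceRule I w V)
    (hq : IsInference w I q) (hw' : Measurable w') (hww : ∀ x ∈ signalSpace N I, w x = w' x)
    (hI : MeasurableSet (signalSpace N I)) (hV : Measurable (stayUtility V w' n))
    (hinteg : Integrable (fun ω => stayUtility V w' n fun i => Y i ω) P)
    (d₀ : Fin N → ℝ → List ℝ → EReal → Node N) (hm : m + 2 ≤ N)
    {T : ℝ × (Fin m → ℝ) → EReal} (hT : Measurable T) {B : Set (Node N)} (hB : MeasurableSet B) :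
    (fun ω => (belief P Y I V w' ρ d₀ n (Y n ω)
        (pathStaying ρ (fun _ => bid w q) (fun i => Y i ω) n m).1
        (T (observed ρ (fun _ => bid w q) n m fun i => Y i ω))).real B)
      =ᵐ[P[|{ω |
        clock (pathStaying ρ (fun _ => bid w q) (fun i => Y i ω) n m).1
          ≤ T (observed ρ (fun _ => bid w q) n m fun i => Y i ω) ∧
        T (observed ρ (fun _ => bid w q) n m fun i => Y i ω)
          < clock (pathStaying ρ (fun _ => bid w q) (fun i => Y i ω) n (m + 1)).1}]]
    (P[|{ω |
        clock (pathStaying ρ (fun _ => bid w q) (fun i => Y i ω) n m).1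
          ≤ T (observed ρ (fun _ => bid w q) n m fun i => Y i ω) ∧
        T (observed ρ (fun _ => bid w q) n m fun i => Y i ω)
          < clock (pathStaying ρ (fun _ => bid w q) (fun i => Y i ω) n (m + 1)).1}])[Set.indicator
        {ω | ((fun i => Y i ω), (pathStaying ρ (fun _ => bid w q) (fun i => Y i ω) n m).2) ∈ B}
        (fun _ => (1 : ℝ)) |
      MeasurableSpace.comap (fun ω => observed ρ (fun _ => bid w q) n m fun i => Y i ω)
        inferInstance] := by
  have hp : ∀ ω, IsOnPath w I q ρ n (fun i => Y i ω) m := fun ω =>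
    isOnPath R hq ρ n (hYI ω) m (by omega)
  have hprices : ∀ ω, (pathStaying ρ (fun _ => bid w q) (fun i => Y i ω) n m).1
      = pricePath w' ρ n (fun i => Y i ω) m := fun ω => by
    rw [(hp ω).prices, pricePath_congr hww ρ n (hYI ω)]
  have hnext : ∀ ω, clock (pathStaying ρ (fun _ => bid w q) (fun i => Y i ω) n (m + 1)).1
      = (nextPrice w' ρ n m fun i => Y i ω : ℝ) := fun ω => by
    rw [(isOnPath R hq ρ n (hYI ω) (m + 1) (by omega)).prices, pricePath_congr hww ρ n (hYI ω)]
    rfl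
  have hobs : ∀ ω, (observed ρ (fun _ => bid w q) n m fun i => Y i ω)
      = orderObserved w' ρ n m fun i => Y i ω := fun ω => by
    simp only [observed, orderObserved, hprices]
  have hnode : ∀ ω, ((fun i => Y i ω), (pathStaying ρ (fun _ => bid w q) (fun i => Y i ω) n m).2)
      = orderNode ρ n m fun i => Y i ω := fun ω => by
    rw [(hp ω).active]
    rfl
  have hobs' : ∀ ω, observation m (Y n ω) (pricePath w' ρ n (fun i => Y i ω) m)
      = orderObserved w' ρ n m fun i => Y i ω := fun ω => rfl
  have hclock : ∀ ω, clock (pricePath w' ρ n (fun i => Y i ω) m)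
      = clock (List.ofFn (orderObserved w' ρ n m fun i => Y i ω).2) := fun ω => by
    simp only [orderObserved, ofFn_getD (length_pricePath w' ρ n _ m)]
  simp only [hobs, hnext, hprices, hnode, hclock]
  set O : Ω → ℝ × (Fin m → ℝ) := fun ω => orderObserved w' ρ n m fun i => Y i ω with hOdef
  set W : Ω → Fin N → ℝ := fun ω i => Y i ω with hWdef
  have hOm : Measurable (orderObserved w' ρ n m) := measurable_orderObserved hw' ρ n m
  have hO : Measurable O := hOm.comp hY
  have hnm : Measurable fun y => ((nextPrice w' ρ n m y : ℝ) : EReal) :=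
    (measurable_nextPrice hw' ρ n m).coe_real_ereal
  -- The event that the buyer looks at the clock between the two drop-outs, as a condition on
  -- observations and signals jointly.
  set Q : Set ((ℝ × (Fin m → ℝ)) × (Fin N → ℝ)) :=
    {z | clock (List.ofFn z.1.2) ≤ T z.1 ∧ T z.1 < (nextPrice w' ρ n m z.2 : ℝ)} with hQdef
  have hQ : MeasurableSet Q :=
    (measurableSet_le ((measurable_clock_ofFn m).comp measurable_fst) (hT.comp measurable_fst)).inter
      (measurableSet_lt (hT.comp measurable_fst) (hnm.comp measurable_snd))
  have hA : MeasurableSet {ω | (O ω, W ω) ∈ Q} := (hO.prodMk hY) hQ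
  have hBayes := cond_condDistrib_ae_eq_condExp (P := P) hY hO hQ
    ((measurableEmbedding_orderNode ρ n m).measurable hB)
  have hpos := ae_cond_condDistrib_ne_zero (P := P) hY hO hQ
  have hsupp : ∀ᵐ ω ∂P, ∀ᵐ y ∂(condDistrib W O P (O ω)),
      y ∈ signalSpace N I ∧ orderObserved w' ρ n m y = O ω :=
    ae_condDistrib hY hO (p := fun z => z.2 ∈ signalSpace N I ∧ orderObserved w' ρ n m z.2 = z.1)
      ((measurable_snd hI).inter (measurableSet_eq_fun (hOm.comp measurable_snd) measurable_fst))
      (Filter.Eventually.of_forall fun ω => ⟨hYI ω, rfl⟩)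
  have hinteg' := ae_integrable_condDistrib (P := P) hY hO hV hinteg
  have habs : P[|{ω | (O ω, W ω) ∈ Q}] ≪ P := cond_absolutelyContinuous
  have hmemA : ∀ᵐ ω ∂P[|{ω | (O ω, W ω) ∈ Q}], (O ω, W ω) ∈ Q :=
    Measure.ae_smul_measure (ae_restrict_mem hA) _
  refine Filter.EventuallyEq.trans ?_ hBayes
  -- These facts are the clauses of `IsRegular`, so almost surely on the event the belief is not the
  -- fallback point mass.
  filter_upwards [hpos, habs.ae_le hsupp, habs.ae_le hinteg', hmemA] with ω h1 h2 h3 h4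
  -- The lower bound on the look-up price depends on the observation only, so the section retains
  -- just the condition on the next drop-out.
  have hset : {y | (O ω, y) ∈ Q} = {y | T (O ω) < (nextPrice w' ρ n m y : ℝ)} := by
    ext y
    exact ⟨fun hy => hy.2, fun hy => ⟨h4.1, hy⟩⟩
  rw [hset] at h1 ⊢
  have hr : IsRegular P Y I V w' ρ n m (Y n ω) (pricePath w' ρ n (W ω) m) (T (O ω)) := ⟨h2, h3, h1⟩
  rw [belief_of_isRegular (length_pricePath w' ρ n (W ω) m) hr, measureReal_def, measureReal_def,
    (measurableEmbedding_orderNode ρ n m).map_apply]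
  rfl

/-- The candidate strategy is a perfect Bayesian equilibrium. -/
theorem exists_isPBE (hY : Measurable fun ω i => Y i ω)
    (hYI : ∀ ω, (fun i => Y i ω) ∈ signalSpace N I) (R : IsPriceRule I w V)
    (hq : IsInference w I q) (hw' : Measurable w') (hww : ∀ x ∈ signalSpace N I, w x = w' x)
    (hI : MeasurableSet (signalSpace N I)) (hV : ∀ n, Measurable (stayUtility V w' n))
    (hinteg : ∀ n, Integrable (fun ω => stayUtility V w' n fun i => Y i ω) P)
    (ρ : Equiv.Perm (Fin N)) :
    ∃ μ : Beliefs N, IsPBE P Y I V ρ (fun _ => bid w q) μ ∧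
      ∀ n y h c, IsInfoSet N I y h c → ∀ᵐ d ∂(μ n y h c),
        (Finset.univ \ d.2).val.map d.1 = (inferred q h : Multiset ℝ) := by
  have hnode : ∀ n a h c, ∃ d : Node N, IsInfoSet N I a h c →
      (d.1 ∈ signalSpace N I ∧ d.1 n = a ∧ n ∈ d.2 ∧ d.2.card + h.length = N) ∧
      (Finset.univ \ d.2).val.map d.1 = (inferred q h : Multiset ℝ) ∧
      ∀ τ : Strategy, nodePayoff V ρ (deviate w q n τ) n h c d
        ≤ nodePayoff V ρ (deviate w q n (bid w q)) n h c d := fun n a h c => by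
    by_cases hi : IsInfoSet N I a h c
    · obtain ⟨d, hd⟩ := exists_node_nodePayoff_le R hq ρ n hi
      exact ⟨d, fun _ => hd⟩
    · exact ⟨(0, ∅), fun h => absurd h hi⟩
  choose d₀ hd₀ using hnode
  set μ : Beliefs N := belief P Y I V w' ρ d₀ with hμ
  have hcases : ∀ n a h c, IsInfoSet N I a h c →
      IsProbabilityMeasure (μ n a h c) ∧
      (∀ᵐ d ∂(μ n a h c),
        (d.1 ∈ signalSpace N I ∧ d.1 n = a ∧ n ∈ d.2 ∧ d.2.card + h.length = N) ∧
        (Finset.univ \ d.2).val.map d.1 = (inferred q h : Multiset ℝ) ∧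
        ∀ τ : Strategy, nodePayoff V ρ (deviate w q n τ) n h c d
          ≤ nodePayoff V ρ (deviate w q n (bid w q)) n h c d) ∧
      Integrable (nodePayoff V ρ (deviate w q n (bid w q)) n h c) (μ n a h c) ∧
      ∀ τ : Strategy, τ.IsMeasurable →
        Integrable (nodePayoff V ρ (deviate w q n τ) n h c) (μ n a h c) := by
    intro n a h c hi
    by_cases hr : IsRegular P Y I V w' ρ n h.length a h c
    · have hmem := hr.ae_mem_reachSet hw'
      have := hr.isProbabilityMeasure
      have he := measurableEmbedding_orderNode ρ n h.length
      rw [hμ, belief_of_isRegular rfl hr]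
      refine ⟨Measure.isProbabilityMeasure_map he.measurable.aemeasurable, ?_,
        integrable_nodePayoff R hq hw' hww hI rfl hi.length_le hmem hr.integrable_stayUtility⟩
      rw [he.ae_map_iff]
      filter_upwards [hmem] with y hy
      have hd := isReached_orderNode R hq hww rfl hi.length_le hy
      exact ⟨⟨hd.consistent.mem, hd.signal, hd.consistent.active, hd.consistent.card⟩,
        hd.consistent.dropped, hd.payoff_le⟩
    · have e : μ n a h c = Measure.dirac (d₀ n a h c) := if_neg hr
      rw [e]
      refine ⟨inferInstance, ?_, integrable_dirac (by simp), fun τ _ => integrable_dirac (by simp)⟩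
      rw [ae_dirac_eq]
      exact hd₀ n a h c hi
  refine ⟨μ, ⟨fun n a h c hi => (hcases n a h c hi).1, fun n a h c hi => ?_, ?_, ?_, ?_⟩,
    fun n a h c hi => ?_⟩
  · filter_upwards [(hcases n a h c hi).2.1] with d hd using hd.1
  · rintro n m hm T hT A rfl B hB
    exact belief_ae_eq_condExp hY hYI R hq hw' hww hI (hV n) (hinteg n) d₀ hm hT hB
  · intro n a h c hi
    have := (hcases n a h c hi).2.2.1
    rwa [deviate_bid] at this
  · intro n a h c hi τ hτ
    obtain ⟨-, h1, h2, h3⟩ := hcases n a h c hi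
    refine ⟨h3 τ hτ, ?_⟩
    have : ∫ d, nodePayoff V ρ (deviate w q n τ) n h c d ∂(μ n a h c)
        ≤ ∫ d, nodePayoff V ρ (deviate w q n (bid w q)) n h c d ∂(μ n a h c) := by
      -- Sequential rationality is the comparison at each node, integrated over the belief.
      refine integral_mono_ae (h3 τ hτ) h2 ?_
      filter_upwards [h1] with d hd using hd.2.2 τ
    rwa [deviate_bid] at this
  · filter_upwards [(hcases n a h c hi).2.1] with d hd using hd.2.1

end Equilibrium

end ProfitSharing

/-! ### Assembly of the theorem for both contracts -/

open ProfitSharing in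
theorem lemma7 {Ω : Type*} [MeasurableSpace Ω] (P : Measure Ω) [IsProbabilityMeasure P]
    (N : ℕ) [NeZero N] (hN : 2 ≤ N) (X Y : Fin N → Ω → ℝ) (I : Set ℝ) (f : (Fin N → ℝ) → ℝ)
    (κ : Fin N → Kernel (Fin N → ℝ) ℝ) (u : ℝ → ℝ) (hM : Model P X Y I f κ u)
    (C : Contract) (α : ℝ) (hα0 : 0 ≤ α) (hα1 : α < 1)
    (hfin : FiniteUtilities P X Y I κ u C α) (ρ : Equiv.Perm (Fin N)) :
    -- the function `s` (or `t`) is well defined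
    (∀ y ∈ signalSpace N I, ∃! b : ℝ, winUtility κ u C α 0 y b = 0) ∧
    -- the equations for the `q_k` have at most one solution
    (∀ qs : List ℝ, qs.length + 2 ≤ N → (∀ x ∈ qs, x ∈ I) →
      Set.InjOn (fun b => indiffPrice κ u C α (stack N b qs)) I) ∧
    ∀ q : List ℝ → ℝ, IsInference (indiffPrice κ u C α) I q →
      -- the inferred signals are ordered like the prices
      (∀ (h : List ℝ) (p p' : ℝ), h.length + 3 ≤ N → p ≤ p' →
        (∃ b ∈ I, SignalEq (indiffPrice κ u C α) q h p b) →
        (∃ b ∈ I, SignalEq (indiffPrice κ u C α) q (p :: h) p' b) →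
        q (p :: h) ≤ q (p' :: p :: h)) ∧
      -- symmetric perfect Bayesian equilibrium
      ∃ μ : Beliefs N,
        IsPBE P Y I (winUtility κ u C α) ρ (fun _ => bid (indiffPrice κ u C α) q) μ ∧
        -- in which the signals of those who have dropped out are believed to be the inferred ones
        ∀ n y h c, IsInfoSet N I y h c → ∀ᵐ d ∂(μ n y h c),
          (Finset.univ \ d.2).val.map d.1 = (inferred q h : Multiset ℝ) := by
  have R := isPriceRule_indiffPrice hM hα0 hα1 hfin
  obtain ⟨w', hw', hww⟩ := exists_measurable_indiffPrice hM hα0 hα1 hfin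
  refine ⟨fun y hy => existsUnique_winUtility_eq_zero hM hα0 hα1 hfin hy,
    fun qs hl hqs => (R.strictMonoOn_stack (by omega) hqs).injOn, fun q hq =>
    ⟨fun h p p' hl hp hs hs' => inference_le_of_le R hq hl hp hs hs', ?_⟩⟩
  exact exists_isPBE (measurable_pi_lambda _ hM.measurable_Y) (fun ω i => hM.signal_mem i ω) R hq
    hw' hww (measurableSet_signalSpace hM.interval)
    (fun n => measurable_winUtility hM n (measurable_finalPrice hw' n))
    (fun n => integrable_winUtility_finalPrice hN hM hfin hw' hww n) ρ
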